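/- Let $\hbar, m, r > 0$, let $x_0\in\mathbf{R}^3$, and let $\chi_{B_{x_0,r}}$ be the characteristic function of the closed ball $B_{x_0,r}=\{x\in\mathbf{R}^3: |x-x_0|\le r\}$. Write $d=|x-x_0|$, $\mathcal{M}_t = \dfrac{m}{2\hbar t}$, and let $\operatorname{erf}(z)=\dfrac{2}{\sqrt\pi}\displaystyle\int_0^z e^{-w^2}\,dw$ be the complex error function. The solution of $$i\hbar\,\partial_t u+\frac{\hbar^2}{2m}\Delta u=0\quad (x\in\mathbf{R}^3,\ t>0),\qquad u(x,0)=\chi_{B_{x_0,r}}(x)\quad (x\in\mathbf{R}^3)$$ is given for $t>0$ and $x\ne x_0$ by $$u(x,t)=\tfrac12\operatorname{erf}\!\left(e^{i3\pi/4}\mathcal{M}_t^{1/2}(d-r)\right)-\tfrac12\operatorname{erf}\!\left(e^{i3\pi/4}\mathcal{M}_t^{1/2}(d+r)\right)+\frac{e^{-i3\pi/4}\left(e^{i\mathcal{M}_t(d-r)^2}-e^{i\mathcal{M}_t(d+r)^2}\right)}{2\,\mathcal{M}_t^{1/2}\,d\,\sqrt\pi},$$ and for $t>0$ and $x=x_0$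 by the limit of this expression as $d\to0^+$, namely $$u(x_0,t)=-\operatorname{erf}\!\left(e^{i3\pi/4}\mathcal{M}_t^{1/2}r\right)+\frac{2e^{i3\pi/4}\,r\,\mathcal{M}_t^{1/2}}{\sqrt\pi}\,e^{i\mathcal{M}_t r^2}.$$ Precisely: the function $u$ given by these formulas for $t>0$ and by $u(\cdot,0)=\chi_{B_{x_0,r}}$ is $C^2$ on $\mathbf{R}^3\times(0,\infty)$ and satisfies the equation at every point there; it belongs to $C([0,\infty);L^2(\mathbf{R}^3))$ and is a weak solution of the Cauchy problem; and every weak solution $v\in C([0,\infty);L^2(\mathbf{R}^3))$ of the same Cauchy problem satisfies $v(\cdot,t)=u(\cdot,t)$ almost everywhere, for every $t\ge0$. Here $v$ is a weak solution if $v(\cdot,0)=\chi_{B_{x_0,r}}$ almost everywhere and, for every $\varphi\in C_c^\infty(\mathbf{R}^3)$, the function $t\mapsto\int_{\mathbf{R}^3} v(x,t)\varphi(x)\,dx$ is differentiable on $(0,\infty)$ with $i\hbar\,\frac{d}{dt}\int_{\mathbf{R}^3} v\,\varphi\,dx+\frac{\hbar^2}{2m}\int_{\mathbf{R}^3} v\,\Delta\varphi\,dx=0$.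 -/

import Mathlib

open MeasureTheory Set Filter Topology
open scoped ENNReal ContDiff Laplacian

noncomputable section

/-- Three-dimensional Euclidean space. -/
abbrev R3 : Type := EuclideanSpace ℝ (Fin 3)

/-- The complex error function `erf z = (2 / √π) ∫_0^z exp (-w ^ 2) dw`, the integral being taken
along the segment `w = s z`, `0 ≤ s ≤ 1`. -/
def cerf (z : ℂ) : ℂ :=
  2 / (Real.sqrt Real.pi : ℂ) * ∫ s in (0 : ℝ)..1, z * Complex.exp (-((s : ℂ) * z) ^ 2)

/-- The characteristic function of the closed ball of radius `r` centred at `x₀`. -/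
def ballChar (x₀ : R3) (r : ℝ) : R3 → ℂ :=
  (Metric.closedBall x₀ r).indicator (fun _ => 1)

/-- `u` is twice continuously differentiable on `(0, ∞) × ℝ³` and satisfies
`i ħ ∂ₜ u + ħ² / (2 m) Δ u = 0` at every point there. -/
def IsClassicalFreeSchrodinger (ħ m : ℝ) (u : ℝ → R3 → ℂ) : Prop :=
  ContDiffOn ℝ 2 (fun p : ℝ × R3 => u p.1 p.2) (Ioi 0 ×ˢ univ) ∧
    ∀ t : ℝ, 0 < t → ∀ x : R3,
      Complex.I * (ħ : ℂ) * deriv (fun s => u s x) t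
        + (ħ : ℂ) ^ 2 / (2 * (m : ℂ)) * Δ (u t) x = 0

/-- `u` is a weak solution in `C([0, ∞); L²(ℝ³))` of the Cauchy problem
`i ħ ∂ₜ u + ħ² / (2 m) Δ u = 0` for `t > 0`, `u(·, 0) = f`. The values of `u` at negative times
play no role. -/
structure IsL2FreeSchrodinger (ħ m : ℝ) (f : R3 → ℂ) (u : ℝ → R3 → ℂ) : Prop where
  memLp : ∀ t : ℝ, 0 ≤ t → MemLp (u t) 2 volume
  continuous_L2 : ∀ t₀ : ℝ, 0 ≤ t₀ →
    Tendsto (fun t => eLpNorm (u t - u t₀) 2 volume) (𝓝[Ici 0] t₀) (𝓝 0)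
  initial : u 0 =ᵐ[volume] f
  weak : ∀ φ : R3 → ℂ, ContDiff ℝ ∞ φ → HasCompactSupport φ → ∀ t : ℝ, 0 < t →
    DifferentiableAt ℝ (fun s => ∫ x, u s x * φ x) t ∧
      Complex.I * (ħ : ℂ) * deriv (fun s => ∫ x, u s x * φ x) t
        + (ħ : ℂ) ^ 2 / (2 * (m : ℂ)) * ∫ x, u t x * Δ φ x = 0

/-- The explicit expression at distance `d ≠ 0` from the centre of the ball, with
`M = m / (2 ħ t)`. -/
def schrodingerProfile (M r d : ℝ) : ℂ :=
  1 / 2 * cerf (Complex.exp (Complex.I * (3 * Real.pi / 4)) * Real.sqrt M * (d - r))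
    - 1 / 2 * cerf (Complex.exp (Complex.I * (3 * Real.pi / 4)) * Real.sqrt M * (d + r))
    + Complex.exp (-(Complex.I * (3 * Real.pi / 4)))
        * (Complex.exp (Complex.I * M * (d - r) ^ 2) - Complex.exp (Complex.I * M * (d + r) ^ 2))
      / (2 * Real.sqrt M * d * Real.sqrt Real.pi)

/-- The explicit expression at the centre of the ball, with `M = m / (2 ħ t)`. -/
def schrodingerCentre (M r : ℝ) : ℂ :=
  -cerf (Complex.exp (Complex.I * (3 * Real.pi / 4)) * Real.sqrt M * r)
    + 2 * Complex.exp (Complex.I * (3 * Real.pi / 4)) * r * Real.sqrt M / Real.sqrt Real.pi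
      * Complex.exp (Complex.I * M * r ^ 2)

end

/-! With `a = ħ / (2m)` the equation is `∂ₜ u = i a Δ u`, and the Fourier transform turns its flow
into multiplication by a symbol of modulus one. The explicit `u` is identified with this unitary
flow applied to the indicator of the ball.

Existence is by duality: `inner_schrodingerPropagator` moves the flow onto a Schwartz test function,
where it can be differentiated in L² (`hasDerivAt_toLp_schwartzPropagator`). Uniqueness
(`eq_zero_of_hasDerivAt_inner`) is by duality too: if `w` is a weak solution with `w 0 = 0` and `γ`
is the Schwartz solution with `γ t = θ`, then `⟪γ s, w s⟫` is constant in `s`, so `⟪θ, w t⟫ = ⟪γ 0,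
w 0⟫ = 0`. As `γ s` need not have compact support, the weak equation is first extended to Schwartz
test functions by cutoffs.

The kernel is a limit of complex Gaussians with real part tending to zero, and is used only against
Schwartz functions. Fubini over the bounded ball then shows that the evolved indicator is a.e. the
absolutely convergent integral `ballIntegral` (`schrodingerPropagator_ballChar_ae_eq`).

Rotating `x - x₀` onto an axis and slicing the ball by orthogonal planes makes each slice
elementary. What remains is the integral of an exponential linear in the height and a Fresnel
integral, which is an error function along the direction `e ^ (3πi / 4)`. Away from the centre and
at it, this gives the two stated formulas; continuity of `ballIntegral` gives the limit as `d → 0⁺`,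
and its smoothness with differentiation under the integral gives the classical equation. -/

/-! ### The propagator on Schwartz functions -/

section SchwartzPropagator

open scoped SchwartzMap FourierTransform

variable {V : Type*} [NormedAddCommGroup V]

theorem hasTemperateGrowth_cexp_ofReal_mul_I :
    (fun x : ℝ => Complex.exp (x * Complex.I)).HasTemperateGrowth := by
  have hderiv : ∀ x : ℝ, HasDerivAt (fun x : ℝ => Complex.exp (x * Complex.I))
      (Complex.exp (x * Complex.I) * Complex.I) x := fun x => by
    simpa using ((Complex.ofRealCLM.hasDerivAt (x := x)).mul_const Complex.I).cexp
  have hsmooth : ContDiff ℝ ∞ (fun x : ℝ => Complex.exp (x * Complex.I)) := by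
    have : ContDiff ℝ ∞ (fun x : ℝ => (x : ℂ) * Complex.I) :=
      Complex.ofRealCLM.contDiff.mul contDiff_const
    exact this.cexp
  refine ⟨hsmooth, fun n => ⟨0, 1, fun x => ?_⟩⟩
  have key : ∀ n : ℕ, iteratedDeriv n (fun x : ℝ => Complex.exp (x * Complex.I))
      = fun x : ℝ => Complex.I ^ n * Complex.exp (x * Complex.I) := by
    intro n
    induction n with
    | zero => simp
    | succ n ih =>
      rw [iteratedDeriv_succ, ih]
      funext x
      rw [((hderiv x).const_mul _).deriv]
      ring
  rw [norm_iteratedFDeriv_eq_norm_iteratedDeriv, key]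
  simp [Complex.norm_exp_ofReal_mul_I]

/-- The symbol `exp (-i a t |2πξ|²)` of the propagator of `∂ₜ u = i a Δ u`. -/
noncomputable def schrodingerSymbol (a t : ℝ) (ξ : V) : ℂ :=
  Complex.exp (((-(a * (2 * Real.pi) ^ 2 * t) * ‖ξ‖ ^ 2 : ℝ) : ℂ) * Complex.I)

@[fun_prop]
theorem schrodingerSymbol_hasTemperateGrowth [InnerProductSpace ℝ V] (a t : ℝ) :
    (schrodingerSymbol a t : V → ℂ).HasTemperateGrowth := by
  have h : (fun ξ : V => -(a * (2 * Real.pi) ^ 2 * t) * ‖ξ‖ ^ 2).HasTemperateGrowth := by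
    fun_prop
  exact hasTemperateGrowth_cexp_ofReal_mul_I.comp h

theorem norm_schrodingerSymbol (a t : ℝ) (ξ : V) : ‖schrodingerSymbol a t ξ‖ = 1 :=
  Complex.norm_exp_ofReal_mul_I _

theorem schrodingerSymbol_zero (a : ℝ) : (schrodingerSymbol a 0 : V → ℂ) = fun _ => 1 := by
  funext ξ
  simp [schrodingerSymbol]

theorem schrodingerSymbol_mul (a s t : ℝ) :
    (schrodingerSymbol a s * schrodingerSymbol a t : V → ℂ) = schrodingerSymbol a (s + t) := by
  funext ξ
  simp only [schrodingerSymbol, Pi.mul_apply, ← Complex.exp_add]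
  congr 1
  push_cast
  ring

theorem conj_schrodingerSymbol (a t : ℝ) (ξ : V) :
    (starRingEnd ℂ) (schrodingerSymbol a t ξ) = schrodingerSymbol a (-t) ξ := by
  simp only [schrodingerSymbol, ← Complex.exp_conj, map_mul, Complex.conj_ofReal, Complex.conj_I]
  congr 1
  push_cast
  ring

/-- Taylor's estimate covers `|x| ≤ 1`; beyond that the triangle inequality gives `2 + |x| ≤ 3 x ^
2`. The bound has to be global because `x` will be a multiple of `‖ξ‖ ^ 2`. -/
theorem norm_cexp_mul_I_sub_one_sub_le (x : ℝ) :
    ‖Complex.exp (x * Complex.I) - 1 - x * Complex.I‖ ≤ 3 * x ^ 2 := by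
  have hx : ‖(x : ℂ) * Complex.I‖ = |x| := by simp
  rcases le_total |x| 1 with h | h
  · have := Complex.norm_exp_sub_one_sub_id_le (x := (x : ℂ) * Complex.I) (by rwa [hx])
    rw [hx, sq_abs] at this
    nlinarith [sq_nonneg x]
  · have h1 : ‖Complex.exp (x * Complex.I) - 1 - x * Complex.I‖ ≤ 1 + 1 + |x| := by
      refine (norm_sub_le _ _).trans (add_le_add ((norm_sub_le _ _).trans ?_) hx.le)
      simp [Complex.norm_exp_ofReal_mul_I]
    nlinarith [sq_abs x]

variable [InnerProductSpace ℝ V] [FiniteDimensional ℝ V] [MeasurableSpace V] [BorelSpace V]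

/-- The propagator of `∂ₜ u = i a Δ u` on Schwartz functions. -/
noncomputable def schwartzPropagator (a t : ℝ) : 𝓢(V, ℂ) →L[ℂ] 𝓢(V, ℂ) :=
  SchwartzMap.fourierMultiplierCLM ℂ (schrodingerSymbol a t)

theorem fourier_schwartzPropagator_apply (a t : ℝ) (θ : 𝓢(V, ℂ)) (ξ : V) :
    𝓕 (schwartzPropagator a t θ) ξ = schrodingerSymbol a t ξ * 𝓕 θ ξ := by
  rw [schwartzPropagator, SchwartzMap.fourierMultiplierCLM_apply,
    FourierTransform.fourier_fourierInv_eq, SchwartzMap.smulLeftCLM_apply_apply (by fun_prop),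
    smul_eq_mul]

theorem schwartzPropagator_zero (a : ℝ) (θ : 𝓢(V, ℂ)) : schwartzPropagator a 0 θ = θ := by
  simp [schwartzPropagator, schrodingerSymbol_zero]

theorem schwartzPropagator_add (a s t : ℝ) (θ : 𝓢(V, ℂ)) :
    schwartzPropagator a s (schwartzPropagator a t θ) = schwartzPropagator a (s + t) θ := by
  simp only [schwartzPropagator]
  rw [SchwartzMap.fourierMultiplierCLM_fourierMultiplierCLM_apply (by fun_prop) (by fun_prop),
    schrodingerSymbol_mul]

theorem fourier_laplacian_apply (θ : 𝓢(V, ℂ)) (ξ : V) :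
    𝓕 (Δ θ) ξ = -((2 * Real.pi) ^ 2 * ‖ξ‖ ^ 2 : ℝ) * 𝓕 θ ξ := by
  have h : (fun ξ : V => ‖ξ‖ ^ 2).HasTemperateGrowth := by fun_prop
  rw [SchwartzMap.laplacian_eq_fourierMultiplierCLM, FourierTransform.fourier_smul,
    SchwartzMap.fourierMultiplierCLM_apply, FourierTransform.fourier_fourierInv_eq,
    _root_.smul_apply, SchwartzMap.smulLeftCLM_apply_apply h]
  simp [mul_assoc]

theorem SchwartzMap.norm_toLp_le_of_norm_le {f g : 𝓢(V, ℂ)} {c : ℝ}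
    (h : ∀ x, ‖f x‖ ≤ c * ‖g x‖) : ‖f.toLp 2 volume‖ ≤ c * ‖g.toLp 2 volume‖ := by
  refine Lp.norm_le_mul_norm_of_ae_le_mul ?_
  filter_upwards [f.coeFn_toLp 2 volume, g.coeFn_toLp 2 volume] with x hf hg
  rw [hf, hg]
  exact h x

theorem SchwartzMap.laplacian_fourierMultiplierCLM {g : V → ℂ} (hg : g.HasTemperateGrowth)
    (θ : 𝓢(V, ℂ)) :
    Δ (SchwartzMap.fourierMultiplierCLM ℂ g θ) = SchwartzMap.fourierMultiplierCLM ℂ g (Δ θ) := by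
  refine (FourierTransform.fourierEquiv ℂ 𝓢(V, ℂ)).injective ?_
  ext ξ
  simp only [FourierTransform.fourierEquiv_apply]
  rw [fourier_laplacian_apply, SchwartzMap.fourierMultiplierCLM_apply,
    SchwartzMap.fourierMultiplierCLM_apply, FourierTransform.fourier_fourierInv_eq,
    FourierTransform.fourier_fourierInv_eq, SchwartzMap.smulLeftCLM_apply_apply hg,
    SchwartzMap.smulLeftCLM_apply_apply hg, fourier_laplacian_apply, smul_eq_mul, smul_eq_mul]
  ring

/-- By Plancherel the remainder may be measured on the Fourier side, where the quadratic Taylor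
bound dominates it by `δ ^ 2` times a multiple of `‖ξ‖ ^ 4 𝓕 θ`, again a Schwartz function. -/
theorem exists_norm_toLp_schwartzPropagator_sub_le (a : ℝ) (θ : 𝓢(V, ℂ)) : ∃ C : ℝ, ∀ δ : ℝ,
    ‖(schwartzPropagator a δ θ - θ - (δ : ℂ) • ((Complex.I * a) • Δ θ)).toLp 2 volume‖
      ≤ C * δ ^ 2 := by
  have h : (fun ξ : V => ‖ξ‖ ^ 2).HasTemperateGrowth := by fun_prop
  let η : 𝓢(V, ℂ) := SchwartzMap.smulLeftCLM ℂ (fun ξ : V => ‖ξ‖ ^ 2)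
    (SchwartzMap.smulLeftCLM ℂ (fun ξ : V => ‖ξ‖ ^ 2) (𝓕 θ))
  refine ⟨3 * (a * (2 * Real.pi) ^ 2) ^ 2 * ‖η.toLp 2 volume‖, fun δ => ?_⟩
  rw [← SchwartzMap.norm_fourier_toL2_eq]
  have := SchwartzMap.norm_toLp_le_of_norm_le (c := 3 * (a * (2 * Real.pi) ^ 2 * δ) ^ 2) (g := η)
    (f := 𝓕 (schwartzPropagator a δ θ - θ - (δ : ℂ) • ((Complex.I * a) • Δ θ))) ?_
  · refine this.trans (le_of_eq ?_)
    ring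
  intro ξ
  have e1 : 𝓕 (schwartzPropagator a δ θ - θ - (δ : ℂ) • ((Complex.I * a) • Δ θ)) ξ
      = (Complex.exp ((-(a * (2 * Real.pi) ^ 2 * δ) * ‖ξ‖ ^ 2 : ℝ) * Complex.I) - 1
        - (-(a * (2 * Real.pi) ^ 2 * δ) * ‖ξ‖ ^ 2 : ℝ) * Complex.I) * 𝓕 θ ξ := by
    have hs : ∀ f g : 𝓢(V, ℂ), 𝓕 (f - g) = 𝓕 f - 𝓕 g := fun f g =>
      map_sub (FourierTransform.fourierCLM ℂ 𝓢(V, ℂ)) f g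
    rw [hs, hs, FourierTransform.fourier_smul, FourierTransform.fourier_smul]
    simp only [_root_.sub_apply, _root_.smul_apply, fourier_schwartzPropagator_apply,
      fourier_laplacian_apply, schrodingerSymbol, smul_eq_mul]
    push_cast
    ring
  have e2 : η ξ = (‖ξ‖ ^ 2 * ‖ξ‖ ^ 2 : ℝ) * 𝓕 θ ξ := by
    simp only [η]
    rw [SchwartzMap.smulLeftCLM_apply_apply h, SchwartzMap.smulLeftCLM_apply_apply h]
    simp [mul_assoc]
  rw [e1, e2, norm_mul, norm_mul, ← mul_assoc]
  refine mul_le_mul_of_nonneg_right ((norm_cexp_mul_I_sub_one_sub_le _).trans (le_of_eq ?_))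
    (norm_nonneg _)
  rw [Complex.norm_real, Real.norm_of_nonneg (by positivity)]
  ring

theorem hasDerivAt_toLp_schwartzPropagator (a s : ℝ) (θ : 𝓢(V, ℂ)) :
    HasDerivAt (fun s => (schwartzPropagator a s θ).toLp 2 volume)
      ((Complex.I * a) • (Δ (schwartzPropagator a s θ)).toLp 2 volume) s := by
  have hz : ∀ θ : 𝓢(V, ℂ), HasDerivAt (fun s => (schwartzPropagator a s θ).toLp 2 volume)
      ((Complex.I * a) • (Δ θ).toLp 2 volume) 0 := by
    intro θ
    obtain ⟨C, hC⟩ := exists_norm_toLp_schwartzPropagator_sub_le a θ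
    rw [hasDerivAt_iff_isLittleO]
    have hO : (fun δ : ℝ => C * δ ^ 2) =o[𝓝 0] fun δ : ℝ => δ - 0 := by
      simp only [sub_zero]
      exact (Asymptotics.isLittleO_pow_id (𝕜 := ℝ) one_lt_two).const_mul_left C
    refine (Asymptotics.IsBigO.of_bound 1 (Eventually.of_forall fun δ => ?_)).trans_isLittleO hO
    rw [one_mul, schwartzPropagator_zero, sub_zero]
    have e : (schwartzPropagator a δ θ).toLp 2 volume - θ.toLp 2 volume
        - δ • (Complex.I * a) • (Δ θ).toLp 2 volume
        = (schwartzPropagator a δ θ - θ - (δ : ℂ) • ((Complex.I * a) • Δ θ)).toLp 2 volume := by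
      let T := SchwartzMap.toLpCLM ℂ ℂ 2 (volume : Measure V)
      change T (schwartzPropagator a δ θ) - T θ - (δ : ℂ) • (Complex.I * a) • T (Δ θ)
        = T (schwartzPropagator a δ θ - θ - (δ : ℂ) • ((Complex.I * a) • Δ θ))
      rw [map_sub, map_sub, map_smul, map_smul]
    rw [e]
    exact (hC δ).trans (le_abs_self _)
  -- The group law carries the derivative from time `0` to time `s`.
  have h := hz (schwartzPropagator a s θ)
  have h2 : HasDerivAt (fun s' : ℝ => s' - s) 1 s := (hasDerivAt_id s).sub_const s
  have h3 := HasDerivAt.scomp_of_eq s h h2 (by simp)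
  simp only [one_smul] at h3
  refine h3.congr_of_eventuallyEq (Eventually.of_forall fun s' => ?_)
  simp only [Function.comp_apply, schwartzPropagator_add, sub_add_cancel]

end SchwartzPropagator

/-! ### Differentiating inner products with a weakly differentiable curve -/

section Hilbert

open scoped InnerProductSpace

variable {H : Type*} [NormedAddCommGroup H] [InnerProductSpace ℂ H]

/-- By Cauchy–Schwarz the derivatives converge uniformly near `s`, since `w` is bounded there; so a
weak equation passes to limits of test vectors. -/
theorem hasDerivAt_inner_of_tendsto {ι : Type*} {l : Filter ι} [l.NeBot] {w : ℝ → H} {s : ℝ}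
    (hw : ContinuousAt w s) {p q : ι → H} {p₀ q₀ : H} (hp : Tendsto p l (𝓝 p₀))
    (hq : Tendsto q l (𝓝 q₀)) (c : ℂ)
    (h : ∀ᶠ z : ι × ℝ in l ×ˢ 𝓝 s,
      HasDerivAt (fun s => ⟪p z.1, w s⟫_ℂ) (c * ⟪q z.1, w z.2⟫_ℂ) z.2) :
    HasDerivAt (fun s => ⟪p₀, w s⟫_ℂ) (c * ⟪q₀, w s⟫_ℂ) s := by
  refine hasDerivAt_of_tendstoUniformlyOnFilter (l := l) (f := fun i s => ⟪p i, w s⟫_ℂ)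
    (f' := fun i s => c * ⟪q i, w s⟫_ℂ) (g' := fun s => c * ⟪q₀, w s⟫_ℂ) ?_ h
    (Eventually.of_forall fun y => hp.inner tendsto_const_nhds)
  rw [Metric.tendstoUniformlyOnFilter_iff]
  intro δ hδ
  have h3 : Tendsto (fun z : ι × ℝ => ‖c‖ * (‖q₀ - q z.1‖ * ‖w z.2‖))
      (l ×ˢ 𝓝 s) (𝓝 (‖c‖ * (‖q₀ - q₀‖ * ‖w s‖))) := by
    refine tendsto_const_nhds.mul (Tendsto.mul ?_ ?_)
    · exact (tendsto_const_nhds.sub (hq.comp tendsto_fst)).norm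
    · exact (hw.tendsto.comp tendsto_snd).norm
  simp only [sub_self, norm_zero, zero_mul, mul_zero] at h3
  filter_upwards [h3.eventually_lt_const hδ] with z hz
  refine lt_of_le_of_lt ?_ hz
  rw [dist_eq_norm, ← mul_sub, ← inner_sub_left, norm_mul]
  gcongr
  exact norm_inner_le_norm _ _

/-- A product rule in which `w` is only continuous and is differentiated only against the frozen
vector `γ s`: the slope splits into `⟪slope γ, w s'⟫` and the slope of `⟪γ s, w ·⟫`. -/
theorem HasDerivAt.inner_of_continuousAt {γ w : ℝ → H} {γ' : H} {d : ℂ} {s : ℝ}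
    (hγ : HasDerivAt γ γ' s) (hw : ContinuousAt w s)
    (hd : HasDerivAt (fun s' => ⟪γ s, w s'⟫_ℂ) d s) :
    HasDerivAt (fun s' => ⟪γ s', w s'⟫_ℂ) (⟪γ', w s⟫_ℂ + d) s := by
  rw [hasDerivAt_iff_tendsto_slope] at hγ hd ⊢
  have h1 : Tendsto (fun s' => ⟪slope γ s s', w s'⟫_ℂ) (𝓝[≠] s) (𝓝 ⟪γ', w s⟫_ℂ) :=
    hγ.inner (hw.tendsto.mono_left nhdsWithin_le_nhds)
  refine (h1.add hd).congr fun s' => ?_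
  simp only [slope, vsub_eq_sub]
  rw [← Complex.coe_smul, inner_smul_left, inner_sub_left, ← Complex.coe_smul, ← Complex.coe_smul,
    smul_eq_mul, smul_eq_mul, Complex.conj_ofReal]
  ring

end Hilbert

/-! ### Cutoffs and uniqueness of weak solutions -/

section WeakSolutions

open scoped SchwartzMap FourierTransform LineDeriv InnerProductSpace

variable {V : Type*} [NormedAddCommGroup V] [InnerProductSpace ℝ V]

/-- The Schwartz function `x ↦ g (ε x) η x`. -/
noncomputable def SchwartzMap.dilateMul (g η : 𝓢(V, ℂ)) (ε : ℝ) : 𝓢(V, ℂ) :=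
  SchwartzMap.smulLeftCLM ℂ (fun x => g (ε • x)) η

theorem SchwartzMap.dilateMul_apply (g η : 𝓢(V, ℂ)) (ε : ℝ) (x : V) :
    SchwartzMap.dilateMul g η ε x = g (ε • x) * η x := by
  have h : (fun x : V => g (ε • x)).HasTemperateGrowth :=
    g.hasTemperateGrowth.comp (ε • ContinuousLinearMap.id ℝ V).hasTemperateGrowth
  rw [SchwartzMap.dilateMul, SchwartzMap.smulLeftCLM_apply_apply h, smul_eq_mul]

theorem SchwartzMap.hasCompactSupport_dilateMul {g : 𝓢(V, ℂ)} (hg : HasCompactSupport g)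
    (η : 𝓢(V, ℂ)) {ε : ℝ} (hε : ε ≠ 0) : HasCompactSupport (SchwartzMap.dilateMul g η ε) := by
  have h : HasCompactSupport (fun x : V => g (ε • x)) :=
    hg.comp_homeomorph (Homeomorph.smulOfNeZero ε hε)
  have : (SchwartzMap.dilateMul g η ε : V → ℂ) = (fun x : V => g (ε • x)) * η :=
    funext fun x => SchwartzMap.dilateMul_apply g η ε x
  rw [this]
  exact h.mul_right

theorem SchwartzMap.lineDeriv_dilateMul (g η : 𝓢(V, ℂ)) (ε : ℝ) (v : V) :
    ∂_{v} (SchwartzMap.dilateMul g η ε)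
      = SchwartzMap.dilateMul g (∂_{v} η) ε + (ε : ℂ) • SchwartzMap.dilateMul (∂_{v} g) η ε := by
  ext x
  have h1 : HasFDerivAt (fun x : V => g (ε • x))
      ((fderiv ℝ g (ε • x)).comp (ε • ContinuousLinearMap.id ℝ V)) x :=
    (g.hasFDerivAt (ε • x)).comp x (ε • ContinuousLinearMap.id ℝ V).hasFDerivAt
  have h2 := h1.mul (η.hasFDerivAt x)
  have h3 : HasFDerivAt (SchwartzMap.dilateMul g η ε) _ x :=
    h2.congr_of_eventuallyEq (Eventually.of_forall fun y => SchwartzMap.dilateMul_apply g η ε y)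
  rw [SchwartzMap.lineDerivOp_apply_eq_fderiv, h3.fderiv]
  simp only [_root_.add_apply, _root_.smul_apply, SchwartzMap.dilateMul_apply,
    SchwartzMap.lineDerivOp_apply_eq_fderiv]
  simp
  ring

variable [FiniteDimensional ℝ V]

theorem exists_schwartz_hasCompactSupport_apply_zero_eq_one :
    ∃ g : 𝓢(V, ℂ), HasCompactSupport g ∧ g 0 = 1 := by
  let f : ContDiffBump (0 : V) := default
  have h1 : HasCompactSupport (fun x => (f x : ℂ)) :=
    f.hasCompactSupport.comp_left (g := fun x : ℝ => (x : ℂ)) (by simp)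
  have h2 : ContDiff ℝ ∞ (fun x => (f x : ℂ)) := Complex.ofRealCLM.contDiff.comp f.contDiff
  refine ⟨h1.toSchwartzMap h2, h1, ?_⟩
  change ((f 0 : ℝ) : ℂ) = 1
  rw [f.one_of_mem_closedBall (by simp [f.rIn_pos.le])]
  simp

variable [MeasurableSpace V] [BorelSpace V]

/-- Since `g` is Lipschitz, `|g (ε x) - g 0| ≤ C |ε| ‖x‖`, and the growth in `x` is absorbed by `η`.
The smooth weight `1 + ‖x‖ ^ 2` replaces `‖x‖` so that the weighted `η` remains Schwartz. -/
theorem SchwartzMap.tendsto_toLp_dilateMul (g η : 𝓢(V, ℂ)) :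
    Tendsto (fun ε => (SchwartzMap.dilateMul g η ε).toLp 2 volume) (𝓝 0)
      (𝓝 (g 0 • η.toLp 2 volume)) := by
  obtain ⟨C, hC⟩ : ∃ C, LipschitzWith C g := by
    obtain ⟨B, hB⟩ := g.decay 0 1
    refine ⟨B.toNNReal, lipschitzWith_of_nnnorm_fderiv_le g.differentiable fun x => ?_⟩
    have := hB.2 x
    rw [pow_zero, one_mul, norm_iteratedFDeriv_one] at this
    exact NNReal.le_toNNReal_of_coe_le this
  have h : (fun x : V => 1 + ‖x‖ ^ 2).HasTemperateGrowth :=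
    (Function.HasTemperateGrowth.const 1).add (by fun_prop)
  let ζ : 𝓢(V, ℂ) := SchwartzMap.smulLeftCLM ℂ (fun x : V => 1 + ‖x‖ ^ 2) η
  have hζ : ∀ x, ‖ζ x‖ = (1 + ‖x‖ ^ 2) * ‖η x‖ := fun x => by
    simp only [ζ]
    rw [SchwartzMap.smulLeftCLM_apply_apply h, norm_smul, Real.norm_of_nonneg (by positivity)]
  rw [tendsto_iff_norm_sub_tendsto_zero]
  have hb : ∀ ε : ℝ, ‖(SchwartzMap.dilateMul g η ε).toLp 2 volume - g 0 • η.toLp 2 volume‖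
      ≤ (C * |ε|) * ‖ζ.toLp 2 volume‖ := by
    intro ε
    have e : (SchwartzMap.dilateMul g η ε).toLp 2 volume - g 0 • η.toLp 2 volume
        = (SchwartzMap.dilateMul g η ε - g 0 • η).toLp 2 volume := by
      let T := SchwartzMap.toLpCLM ℂ ℂ 2 (volume : Measure V)
      change T (SchwartzMap.dilateMul g η ε) - g 0 • T η
        = T (SchwartzMap.dilateMul g η ε - g 0 • η)
      rw [map_sub, map_smul]
    rw [e]
    refine SchwartzMap.norm_toLp_le_of_norm_le fun x => ?_
    rw [hζ, _root_.sub_apply, _root_.smul_apply, SchwartzMap.dilateMul_apply, smul_eq_mul,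
      ← sub_mul, norm_mul, ← mul_assoc]
    refine mul_le_mul_of_nonneg_right ?_ (norm_nonneg _)
    have h1 := hC.dist_le_mul (ε • x) 0
    rw [dist_eq_norm, dist_zero_right, norm_smul, Real.norm_eq_abs] at h1
    refine h1.trans ?_
    rw [mul_assoc]
    gcongr
    nlinarith [sq_nonneg (‖x‖ - 1), norm_nonneg x]
  refine squeeze_zero (fun _ => norm_nonneg _) hb ?_
  have : Tendsto (fun ε : ℝ => (C * |ε|) * ‖ζ.toLp 2 volume‖) (𝓝 0)
      (𝓝 ((C * |0|) * ‖ζ.toLp 2 volume‖)) := by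
    exact (Continuous.tendsto (by fun_prop) _)
  simpa using this

/-- Each derivative falling on the cutoff brings out a factor `ε`, so only the term with both
derivatives on `η` survives. -/
theorem SchwartzMap.tendsto_toLp_laplacian_dilateMul (g η : 𝓢(V, ℂ)) :
    Tendsto (fun ε => (Δ (SchwartzMap.dilateMul g η ε)).toLp 2 volume) (𝓝 0)
      (𝓝 (g 0 • (Δ η).toLp 2 volume)) := by
  let b := stdOrthonormalBasis ℝ V
  let T := SchwartzMap.toLpCLM ℂ ℂ 2 (volume : Measure V)
  change Tendsto (fun ε => T (Δ (SchwartzMap.dilateMul g η ε))) (𝓝 0) (𝓝 (g 0 • T (Δ η)))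
  have hT : ∀ g η : 𝓢(V, ℂ),
      Tendsto (fun ε => T (SchwartzMap.dilateMul g η ε)) (𝓝 0) (𝓝 (g 0 • T η)) :=
    SchwartzMap.tendsto_toLp_dilateMul
  have hε : Tendsto (fun ε : ℝ => (ε : ℂ)) (𝓝 0) (𝓝 0) := by
    simpa using (Complex.continuous_ofReal.tendsto 0)
  simp only [SchwartzMap.laplacian_eq_sum b, map_sum, Finset.smul_sum]
  refine tendsto_finsetSum _ fun i _ => ?_
  have e : ∀ ε : ℝ, T (∂_{b i} (∂_{b i} (SchwartzMap.dilateMul g η ε)))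
      = T (SchwartzMap.dilateMul g (∂_{b i} (∂_{b i} η)) ε)
        + (ε : ℂ) • T (SchwartzMap.dilateMul (∂_{b i} g) (∂_{b i} η) ε)
        + (ε : ℂ) • (T (SchwartzMap.dilateMul (∂_{b i} g) (∂_{b i} η) ε)
        + (ε : ℂ) • T (SchwartzMap.dilateMul (∂_{b i} (∂_{b i} g)) η ε)) := by
    intro ε
    rw [SchwartzMap.lineDeriv_dilateMul, LineDeriv.lineDerivOp_add, LineDeriv.lineDerivOp_smul,
      SchwartzMap.lineDeriv_dilateMul, SchwartzMap.lineDeriv_dilateMul]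
    simp only [map_add, map_smul]
  simp only [e]
  have := ((hT g (∂_{b i} (∂_{b i} η))).add (hε.smul (hT (∂_{b i} g) (∂_{b i} η)))).add
    (hε.smul ((hT (∂_{b i} g) (∂_{b i} η)).add (hε.smul (hT (∂_{b i} (∂_{b i} g)) η))))
  simpa using this

/-- A weak solution of `∂ₜ w = i a Δ w`, tested against compactly supported functions, may be
tested against Schwartz functions. -/
theorem hasDerivAt_inner_of_hasCompactSupport {a : ℝ} {w : ℝ → Lp ℂ 2 (volume : Measure V)}
    (hc : ContinuousOn w (Ici 0))
    (hw : ∀ θ : 𝓢(V, ℂ), HasCompactSupport θ → ∀ s : ℝ, 0 < s →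
      HasDerivAt (fun s => ⟪θ.toLp 2 volume, w s⟫_ℂ)
        (Complex.I * a * ⟪(Δ θ).toLp 2 volume, w s⟫_ℂ) s)
    (θ : 𝓢(V, ℂ)) {s : ℝ} (hs : 0 < s) :
    HasDerivAt (fun s => ⟪θ.toLp 2 volume, w s⟫_ℂ)
        (Complex.I * a * ⟪(Δ θ).toLp 2 volume, w s⟫_ℂ) s := by
  obtain ⟨g, hg, hg0⟩ := exists_schwartz_hasCompactSupport_apply_zero_eq_one (V := V)
  have hcs : ContinuousAt w s := hc.continuousAt (Ici_mem_nhds hs)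
  have h1 : Tendsto (fun ε => (SchwartzMap.dilateMul g θ ε).toLp 2 volume) (𝓝[≠] 0)
      (𝓝 (θ.toLp 2 volume)) := by
    simpa [hg0] using (SchwartzMap.tendsto_toLp_dilateMul g θ).mono_left nhdsWithin_le_nhds
  have h2 : Tendsto (fun ε => (Δ (SchwartzMap.dilateMul g θ ε)).toLp 2 volume) (𝓝[≠] 0)
      (𝓝 ((Δ θ).toLp 2 volume)) := by
    simpa [hg0] using
      (SchwartzMap.tendsto_toLp_laplacian_dilateMul g θ).mono_left nhdsWithin_le_nhds
  refine hasDerivAt_inner_of_tendsto hcs h1 h2 (Complex.I * a) ?_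
  -- The neighbourhood is punctured because at `ε = 0` the cutoff is constant and no longer gives
  -- compact support.
  have e1 : ∀ᶠ ε : ℝ in 𝓝[≠] 0, ε ≠ 0 := eventually_mem_nhdsWithin
  filter_upwards [e1.prod_mk (Ioi_mem_nhds hs)] with p hp
  exact hw _ (SchwartzMap.hasCompactSupport_dilateMul hg θ hp.1) _ hp.2

theorem eq_zero_of_forall_inner_schwartz_eq_zero {f : Lp ℂ 2 (volume : Measure V)}
    (h : ∀ θ : 𝓢(V, ℂ), ⟪θ.toLp 2 volume, f⟫_ℂ = 0) : f = 0 := by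
  have hd := SchwartzMap.denseRange_toLpCLM (E := V) (F := ℂ) (p := 2) (μ := volume) (by simp)
  exact hd.eq_zero_of_inner_right ℂ h

/-- A weak solution of `∂ₜ w = i a Δ w` in `C([0, ∞); L²)` which vanishes initially is zero. -/
theorem eq_zero_of_hasDerivAt_inner {a : ℝ} {w : ℝ → Lp ℂ 2 (volume : Measure V)}
    (hc : ContinuousOn w (Ici 0)) (h0 : w 0 = 0)
    (hw : ∀ θ : 𝓢(V, ℂ), HasCompactSupport θ → ∀ s : ℝ, 0 < s →
      HasDerivAt (fun s => ⟪θ.toLp 2 volume, w s⟫_ℂ)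
        (Complex.I * a * ⟪(Δ θ).toLp 2 volume, w s⟫_ℂ) s)
    {t : ℝ} (ht : 0 ≤ t) : w t = 0 := by
  refine eq_zero_of_forall_inner_schwartz_eq_zero fun θ => ?_
  -- The Schwartz solution of the same equation that passes through `θ` at time `t`.
  let γ : ℝ → Lp ℂ 2 (volume : Measure V) :=
    fun s => (schwartzPropagator a s (schwartzPropagator a (-t) θ)).toLp 2 volume
  have hγ : ∀ s, HasDerivAt γ _ s := fun s => hasDerivAt_toLp_schwartzPropagator a s _
  have hγt : γ t = θ.toLp 2 volume := by
    simp [γ, schwartzPropagator_add, schwartzPropagator_zero]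
  have hγc : Continuous γ := continuous_iff_continuousAt.2 fun s => (hγ s).continuousAt
  have hderiv : ∀ s, 0 < s → HasDerivAt (fun s => ⟪γ s, w s⟫_ℂ) 0 s := by
    intro s hs
    have A := (hγ s).inner_of_continuousAt (hc.continuousAt (Ici_mem_nhds hs))
      (hasDerivAt_inner_of_hasCompactSupport hc hw
        (schwartzPropagator a s (schwartzPropagator a (-t) θ)) hs)
    convert A using 1
    -- The inner product conjugates its first slot, so the `i a` coming from `γ` becomes `-i a` and
    -- cancels the one coming from `w`.
    rw [inner_smul_left]
    simp
  have hcont : ContinuousOn (fun s => ⟪γ s, w s⟫_ℂ) (Ici 0) := hγc.continuousOn.inner hc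
  rcases ht.eq_or_lt with rfl | ht
  · simp [h0]
  -- The weak equation is available only at positive times; the initial time is reached by letting
  -- `δ → 0⁺`.
  have hconst : ∀ δ ∈ Ioo 0 t, ⟪γ t, w t⟫_ℂ = ⟪γ δ, w δ⟫_ℂ := fun δ hδ =>
    constant_of_has_deriv_right_zero
      (hcont.mono (Icc_subset_Ici_self.trans (Ici_subset_Ici.2 hδ.1.le)))
      (fun s hs => (hderiv s (hδ.1.trans_le hs.1)).hasDerivWithinAt) t ⟨hδ.2.le, le_rfl⟩
  have hlim : Tendsto (fun δ => ⟪γ δ, w δ⟫_ℂ) (𝓝[>] 0) (𝓝 ⟪γ 0, w 0⟫_ℂ) :=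
    (hcont 0 self_mem_Ici).mono Ioi_subset_Ici_self
  have hlim' : Tendsto (fun δ => ⟪γ δ, w δ⟫_ℂ) (𝓝[>] 0) (𝓝 ⟪γ t, w t⟫_ℂ) := by
    refine tendsto_const_nhds.congr' ?_
    filter_upwards [Ioo_mem_nhdsGT ht] with δ hδ using hconst δ hδ
  rw [← hγt, tendsto_nhds_unique hlim' hlim, h0, inner_zero_right]

end WeakSolutions

/-! ### The unitary propagator on L² -/

section L2Propagator

open scoped SchwartzMap FourierTransform InnerProductSpace

variable {V : Type*} [NormedAddCommGroup V] [InnerProductSpace ℝ V] [FiniteDimensional ℝ V]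
  [MeasurableSpace V] [BorelSpace V]

theorem memLp_schrodingerSymbol_mul (a t : ℝ) (g : Lp ℂ 2 (volume : Measure V)) :
    MemLp (fun ξ => schrodingerSymbol a t ξ * g ξ) 2 volume := by
  have hs : Continuous (schrodingerSymbol a t : V → ℂ) :=
    (schrodingerSymbol_hasTemperateGrowth a t).1.continuous
  refine (Lp.memLp g).of_le (hs.aestronglyMeasurable.mul (Lp.aestronglyMeasurable g))
    (Eventually.of_forall fun ξ => ?_)
  rw [norm_mul, norm_schrodingerSymbol, one_mul]

/-- Multiplication by the symbol of the propagator of `∂ₜ u = i a Δ u` on `L²`. -/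
noncomputable def schrodingerSymbolMul (a t : ℝ) (g : Lp ℂ 2 (volume : Measure V)) :
    Lp ℂ 2 (volume : Measure V) :=
  (memLp_schrodingerSymbol_mul a t g).toLp _

theorem coeFn_schrodingerSymbolMul (a t : ℝ) (g : Lp ℂ 2 (volume : Measure V)) :
    schrodingerSymbolMul a t g =ᵐ[volume] fun ξ => schrodingerSymbol a t ξ * g ξ :=
  MemLp.coeFn_toLp _

theorem schrodingerSymbolMul_sub (a t : ℝ) (g h : Lp ℂ 2 (volume : Measure V)) :
    schrodingerSymbolMul a t (g - h) = schrodingerSymbolMul a t g - schrodingerSymbolMul a t h := by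
  refine Lp.ext ?_
  filter_upwards [coeFn_schrodingerSymbolMul a t g, coeFn_schrodingerSymbolMul a t h,
    coeFn_schrodingerSymbolMul a t (g - h), Lp.coeFn_sub g h,
    Lp.coeFn_sub (schrodingerSymbolMul a t g) (schrodingerSymbolMul a t h)] with ξ h1 h2 h3 h4 h5
  rw [h3, h5, h4, Pi.sub_apply, Pi.sub_apply, h1, h2, mul_sub]

theorem norm_schrodingerSymbolMul (a t : ℝ) (g : Lp ℂ 2 (volume : Measure V)) :
    ‖schrodingerSymbolMul a t g‖ = ‖g‖ := by
  rw [schrodingerSymbolMul, Lp.norm_toLp, Lp.norm_def]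
  congr 1
  refine eLpNorm_congr_norm_ae (Eventually.of_forall fun ξ => ?_)
  rw [norm_mul, norm_schrodingerSymbol, one_mul]

/-- The propagator of `∂ₜ u = i a Δ u` on `L²`. -/
noncomputable def schrodingerPropagator (a t : ℝ) (g : Lp ℂ 2 (volume : Measure V)) :
    Lp ℂ 2 (volume : Measure V) :=
  𝓕⁻ (schrodingerSymbolMul a t (𝓕 g))

theorem norm_schrodingerPropagator_sub (a t : ℝ) (g h : Lp ℂ 2 (volume : Measure V)) :
    ‖schrodingerPropagator a t g - schrodingerPropagator a t h‖ = ‖g - h‖ := by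
  have hF : ∀ x y : Lp ℂ 2 (volume : Measure V), 𝓕 (x - y) = 𝓕 x - 𝓕 y := fun x y =>
    map_sub (FourierTransform.fourierCLM ℂ (Lp ℂ 2 (volume : Measure V))) x y
  rw [← Lp.norm_fourier_eq, hF, schrodingerPropagator, schrodingerPropagator,
    FourierTransform.fourier_fourierInv_eq, FourierTransform.fourier_fourierInv_eq,
    ← schrodingerSymbolMul_sub, norm_schrodingerSymbolMul, ← hF, Lp.norm_fourier_eq]

theorem schrodingerPropagator_toLp (a t : ℝ) (θ : 𝓢(V, ℂ)) :
    schrodingerPropagator a t (θ.toLp 2 volume) = (schwartzPropagator a t θ).toLp 2 volume := by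
  have h : schrodingerSymbolMul a t (𝓕 (θ.toLp 2 volume))
      = 𝓕 ((schwartzPropagator a t θ).toLp 2 volume) := by
    rw [SchwartzMap.toLp_fourier_eq, SchwartzMap.toLp_fourier_eq]
    refine Lp.ext ?_
    filter_upwards [coeFn_schrodingerSymbolMul a t ((𝓕 θ).toLp 2 volume),
      (𝓕 θ).coeFn_toLp 2 volume, (𝓕 (schwartzPropagator a t θ)).coeFn_toLp 2 volume]
      with ξ h1 h2 h3
    rw [h1, h2, h3, fourier_schwartzPropagator_apply]
  rw [schrodingerPropagator, h, FourierTransform.fourierInv_fourier_eq]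

/-- Plancherel, together with the fact that conjugating the symbol reverses time. It transfers
questions about the L² flow to the Schwartz flow. -/
theorem inner_schrodingerPropagator (a t : ℝ) (θ : 𝓢(V, ℂ)) (g : Lp ℂ 2 (volume : Measure V)) :
    ⟪θ.toLp 2 volume, schrodingerPropagator a t g⟫_ℂ
      = ⟪(schwartzPropagator a (-t) θ).toLp 2 volume, g⟫_ℂ := by
  rw [← Lp.inner_fourier_eq, ← Lp.inner_fourier_eq _ g, schrodingerPropagator,
    FourierTransform.fourier_fourierInv_eq, SchwartzMap.toLp_fourier_eq,
    SchwartzMap.toLp_fourier_eq, L2.inner_def, L2.inner_def]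
  refine integral_congr_ae ?_
  filter_upwards [coeFn_schrodingerSymbolMul a t (𝓕 g), (𝓕 θ).coeFn_toLp 2 volume,
    (𝓕 (schwartzPropagator a (-t) θ)).coeFn_toLp 2 volume] with ξ h1 h2 h3
  rw [h1, h2, h3, fourier_schwartzPropagator_apply]
  simp only [RCLike.inner_apply, map_mul, conj_schrodingerSymbol, neg_neg]
  ring

theorem schrodingerPropagator_zero (a : ℝ) (g : Lp ℂ 2 (volume : Measure V)) :
    schrodingerPropagator a 0 g = g := by
  rw [← sub_eq_zero]
  refine eq_zero_of_forall_inner_schwartz_eq_zero fun θ => ?_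
  rw [inner_sub_right, inner_schrodingerPropagator, neg_zero, schwartzPropagator_zero, sub_self]

/-- Schwartz data have continuous orbits, and the isometry makes the error of approximating `g` by
such data uniform in time. -/
theorem continuous_schrodingerPropagator (a : ℝ) (g : Lp ℂ 2 (volume : Measure V)) :
    Continuous fun t => schrodingerPropagator a t g := by
  have hd := SchwartzMap.denseRange_toLpCLM (E := V) (F := ℂ) (p := 2) (μ := volume) (by simp)
  rw [Metric.continuous_iff']
  intro t ε hε
  obtain ⟨θ, hθ⟩ := hd.exists_dist_lt g (ε := ε / 3) (by positivity)
  rw [SchwartzMap.toLpCLM_apply] at hθ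
  have h1 := (hasDerivAt_toLp_schwartzPropagator a t θ).continuousAt
  filter_upwards [Metric.continuousAt_iff'.1 h1 (ε / 3) (by positivity)] with s hs
  rw [← schrodingerPropagator_toLp, ← schrodingerPropagator_toLp] at hs
  have e : ∀ s, dist (schrodingerPropagator a s g) (schrodingerPropagator a s (θ.toLp 2 volume))
      < ε / 3 := fun s => by
    rw [dist_eq_norm, norm_schrodingerPropagator_sub, ← dist_eq_norm]
    exact hθ
  have := dist_triangle4_right (schrodingerPropagator a s g) (schrodingerPropagator a t g)
    (schrodingerPropagator a s (θ.toLp 2 volume)) (schrodingerPropagator a t (θ.toLp 2 volume))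
  linarith [e s, e t]

theorem hasDerivAt_inner_schrodingerPropagator (a s : ℝ) (θ : 𝓢(V, ℂ))
    (g : Lp ℂ 2 (volume : Measure V)) :
    HasDerivAt (fun s => ⟪θ.toLp 2 volume, schrodingerPropagator a s g⟫_ℂ)
      (Complex.I * a * ⟪(Δ θ).toLp 2 volume, schrodingerPropagator a s g⟫_ℂ) s := by
  simp only [inner_schrodingerPropagator]
  -- The sign from reversing time cancels the one from conjugating `i`.
  have h1 := (hasDerivAt_toLp_schwartzPropagator a (-s) θ).scomp s (hasDerivAt_neg s)
  have h2 := h1.inner_of_continuousAt (w := fun _ => g) continuousAt_const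
    (hasDerivAt_const s _)
  refine h2.congr_deriv ?_
  rw [schwartzPropagator,
    SchwartzMap.laplacian_fourierMultiplierCLM (schrodingerSymbol_hasTemperateGrowth _ _),
    add_zero, neg_smul, one_smul, inner_neg_left, inner_smul_left]
  simp

end L2Propagator

/-! ### The oscillatory kernel and the evolution of a ball -/

section Kernel

open scoped SchwartzMap FourierTransform InnerProductSpace

section

variable {V : Type*} [NormedAddCommGroup V] [InnerProductSpace ℝ V] [FiniteDimensional ℝ V]
  [MeasurableSpace V] [BorelSpace V]

/-- The Fourier transform is self-adjoint for the bilinear pairing, and that of a modulated Gaussian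
is explicit. -/
theorem SchwartzMap.integral_gaussian_mul_fourier (θ : 𝓢(V, ℂ)) {b : ℂ} (hb : 0 < b.re) (y : V) :
    ∫ ξ : V, Complex.exp (-b * ‖ξ‖ ^ 2 + 2 * Real.pi * Complex.I * ⟪y, ξ⟫_ℝ) * 𝓕 θ ξ
      = (Real.pi / b) ^ (Module.finrank ℝ V / 2 : ℂ)
        * ∫ x : V, Complex.exp (-Real.pi ^ 2 * ‖y - x‖ ^ 2 / b) * θ x := by
  have hg : Integrable (fun ξ : V =>
      Complex.exp (-b * ‖ξ‖ ^ 2 + 2 * Real.pi * Complex.I * ⟪y, ξ⟫_ℝ)) :=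
    GaussianFourier.integrable_cexp_neg_mul_sq_norm_add hb _ y
  have h := VectorFourier.integral_fourierIntegral_smul_eq_flip (L := innerₗ V)
    Real.continuous_fourierChar continuous_inner hg (θ.integrable (μ := volume))
  have e1 : ∀ x, VectorFourier.fourierIntegral Real.fourierChar volume (innerₗ V) (fun ξ : V =>
      Complex.exp (-b * ‖ξ‖ ^ 2 + 2 * Real.pi * Complex.I * ⟪y, ξ⟫_ℝ)) x
      = (Real.pi / b) ^ (Module.finrank ℝ V / 2 : ℂ)
        * Complex.exp (-Real.pi ^ 2 * ‖y - x‖ ^ 2 / b) :=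
    fun x => fourier_gaussian_innerProductSpace' hb y x
  have e2 : ∀ ξ, VectorFourier.fourierIntegral Real.fourierChar volume (innerₗ V).flip θ ξ
      = 𝓕 θ ξ := fun ξ => by
    rw [flip_innerₗ]
    rfl
  simp only [e1, e2, smul_eq_mul] at h
  rw [← h, ← integral_const_mul]
  simp only [mul_assoc]

/-- The limit `ε → 0⁺` of the Gaussian identity at `b = ε + i l`. Both exponentials have modulus at
most one, so `‖𝓕 θ‖` and `‖θ‖` dominate the two integrands. -/
theorem SchwartzMap.integral_oscillatory_gaussian_mul_fourier (θ : 𝓢(V, ℂ)) {l : ℝ} (hl : l ≠ 0)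
    (y : V) :
    ∫ ξ : V, Complex.exp (-(l * Complex.I) * ‖ξ‖ ^ 2 + 2 * Real.pi * Complex.I * ⟪y, ξ⟫_ℝ) * 𝓕 θ ξ
      = (Real.pi / (l * Complex.I)) ^ (Module.finrank ℝ V / 2 : ℂ)
        * ∫ x : V, Complex.exp (-Real.pi ^ 2 * ‖y - x‖ ^ 2 / (l * Complex.I)) * θ x := by
  have hl' : (l : ℂ) * Complex.I ≠ 0 := by simp [hl]
  have hb : Tendsto (fun ε : ℝ => (ε : ℂ) + l * Complex.I) (𝓝[>] 0) (𝓝 (l * Complex.I)) := by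
    have : Tendsto (fun ε : ℝ => (ε : ℂ) + l * Complex.I) (𝓝 0) (𝓝 ((0 : ℝ) + l * Complex.I)) :=
      Continuous.tendsto (by fun_prop) _
    simpa using this.mono_left nhdsWithin_le_nhds
  have hpos : ∀ᶠ ε : ℝ in 𝓝[>] 0, 0 < ε := eventually_mem_nhdsWithin
  have hre : ∀ ε : ℝ, ((ε : ℂ) + l * Complex.I).re = ε := fun ε => by simp
  have hL : Tendsto (fun ε : ℝ => ∫ ξ : V, Complex.exp (-((ε : ℂ) + l * Complex.I) * ‖ξ‖ ^ 2
        + 2 * Real.pi * Complex.I * ⟪y, ξ⟫_ℝ) * 𝓕 θ ξ) (𝓝[>] 0)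
      (𝓝 (∫ ξ : V, Complex.exp (-(l * Complex.I) * ‖ξ‖ ^ 2
        + 2 * Real.pi * Complex.I * ⟪y, ξ⟫_ℝ) * 𝓕 θ ξ)) := by
    refine tendsto_integral_filter_of_dominated_convergence (fun ξ => ‖𝓕 θ ξ‖)
      (Eventually.of_forall fun ε => ?_) ?_ (𝓕 θ).integrable.norm (Eventually.of_forall fun ξ => ?_)
    · exact (Continuous.mul (by fun_prop) (𝓕 θ).continuous).aestronglyMeasurable
    · filter_upwards [hpos] with ε hε
      refine Eventually.of_forall fun ξ => ?_
      rw [norm_mul, Complex.norm_exp]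
      refine mul_le_of_le_one_left (norm_nonneg _) (Real.exp_le_one_iff.2 ?_)
      have : (-((ε : ℂ) + l * Complex.I) * ‖ξ‖ ^ 2 + 2 * Real.pi * Complex.I * ⟪y, ξ⟫_ℝ).re
          = -(ε * ‖ξ‖ ^ 2) := by
        have : -((ε : ℂ) + l * Complex.I) * ‖ξ‖ ^ 2 + 2 * Real.pi * Complex.I * ⟪y, ξ⟫_ℝ
            = ((-(ε * ‖ξ‖ ^ 2) : ℝ) : ℂ)
              + ((-l * ‖ξ‖ ^ 2 + 2 * Real.pi * ⟪y, ξ⟫_ℝ : ℝ) : ℂ) * Complex.I := by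
          push_cast
          ring
        rw [this, Complex.add_re, Complex.ofReal_re, Complex.re_ofReal_mul, Complex.I_re,
          mul_zero, add_zero]
      rw [this]
      exact neg_nonpos.2 (by positivity)
    · exact (((hb.neg.mul_const _).add_const _).cexp).mul_const _
  have hR : Tendsto (fun ε : ℝ => (Real.pi / ((ε : ℂ) + l * Complex.I)) ^
        (Module.finrank ℝ V / 2 : ℂ)
        * ∫ x : V, Complex.exp (-Real.pi ^ 2 * ‖y - x‖ ^ 2 / ((ε : ℂ) + l * Complex.I)) * θ x)
      (𝓝[>] 0) (𝓝 ((Real.pi / (l * Complex.I)) ^ (Module.finrank ℝ V / 2 : ℂ)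
        * ∫ x : V, Complex.exp (-Real.pi ^ 2 * ‖y - x‖ ^ 2 / (l * Complex.I)) * θ x)) := by
    refine Tendsto.mul ?_ ?_
    · refine Tendsto.cpow (tendsto_const_nhds.div hb hl') tendsto_const_nhds ?_
      -- The limiting base is a nonzero imaginary number, hence off the branch cut, and the
      -- principal power is continuous there.
      have : (Real.pi : ℂ) / (l * Complex.I) = ((-(Real.pi / l) : ℝ) : ℂ) * Complex.I := by
        have hlc : (l : ℂ) ≠ 0 := by simpa using hl
        push_cast
        field_simp
        simp
      rw [this, Complex.mem_slitPlane_iff]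
      refine Or.inr ?_
      simp [hl, Real.pi_ne_zero]
    · refine tendsto_integral_filter_of_dominated_convergence (fun ξ => ‖θ ξ‖)
        (Eventually.of_forall fun ε => ?_) ?_ θ.integrable.norm (Eventually.of_forall fun ξ => ?_)
      · exact (Continuous.mul (by fun_prop) θ.continuous).aestronglyMeasurable
      · filter_upwards [hpos] with ε hε
        refine Eventually.of_forall fun x => ?_
        rw [norm_mul, Complex.norm_exp]
        refine mul_le_of_le_one_left (norm_nonneg _) (Real.exp_le_one_iff.2 ?_)
        have : (-(Real.pi : ℂ) ^ 2 * ‖y - x‖ ^ 2 / ((ε : ℂ) + l * Complex.I)).re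
            = -((Real.pi * ‖y - x‖) ^ 2 * (ε / Complex.normSq ((ε : ℂ) + l * Complex.I))) := by
          have : (-(Real.pi : ℂ) ^ 2 * ‖y - x‖ ^ 2 / ((ε : ℂ) + l * Complex.I))
              = ((-(Real.pi * ‖y - x‖) ^ 2 : ℝ) : ℂ) * ((ε : ℂ) + l * Complex.I)⁻¹ := by
            push_cast
            ring
          rw [this, Complex.re_ofReal_mul, Complex.inv_re, hre]
          ring
        rw [this]
        exact neg_nonpos.2 (mul_nonneg (sq_nonneg _) (div_nonneg hε.le (Complex.normSq_nonneg _)))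
      · exact ((tendsto_const_nhds.div hb hl').cexp).mul_const _
  refine tendsto_nhds_unique hL (hR.congr' ?_)
  filter_upwards [hpos] with ε hε
  exact (θ.integral_gaussian_mul_fourier (by rwa [hre]) y).symm

theorem schwartzPropagator_apply_eq_integral {a t : ℝ} (hat : a * t ≠ 0) (θ : 𝓢(V, ℂ)) (y : V) :
    schwartzPropagator a t θ y
      = (((1 / (4 * Real.pi * (a * t)) : ℝ) : ℂ) * -Complex.I) ^ (Module.finrank ℝ V / 2 : ℂ)
        * ∫ x : V, Complex.exp (Complex.I * (1 / (4 * (a * t)) : ℝ) * ‖y - x‖ ^ 2) * θ x := by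
  have hl : a * (2 * Real.pi) ^ 2 * t ≠ 0 := by
    have := Real.pi_ne_zero
    have h1 := left_ne_zero_of_mul hat
    have h2 := right_ne_zero_of_mul hat
    positivity
  have hat' : (a : ℂ) * t ≠ 0 := by exact_mod_cast hat
  have h1 := left_ne_zero_of_mul hat'
  have h2 := right_ne_zero_of_mul hat'
  have hpi : (Real.pi : ℂ) ≠ 0 := by exact_mod_cast Real.pi_ne_zero
  have h := θ.integral_oscillatory_gaussian_mul_fourier hl y
  have e1 : (Real.pi : ℂ) / ((a * (2 * Real.pi) ^ 2 * t : ℝ) * Complex.I)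
      = ((1 / (4 * Real.pi * (a * t)) : ℝ) : ℂ) * -Complex.I := by
    rw [mul_comm _ Complex.I, ← div_div, div_eq_mul_inv _ Complex.I, Complex.inv_I]
    push_cast
    field_simp
    norm_num
  have e2 : ∀ x : V, -(Real.pi : ℂ) ^ 2 * ‖y - x‖ ^ 2
      / ((a * (2 * Real.pi) ^ 2 * t : ℝ) * Complex.I)
      = Complex.I * (1 / (4 * (a * t)) : ℝ) * ‖y - x‖ ^ 2 := fun x => by
    rw [mul_comm _ Complex.I, ← div_div, div_eq_mul_inv _ Complex.I, Complex.inv_I]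
    push_cast
    field_simp
    norm_num
  rw [e1] at h
  simp only [e2] at h
  rw [← h, schwartzPropagator, SchwartzMap.fourierMultiplierCLM_apply, SchwartzMap.fourierInv_coe,
    Real.fourierInv_eq']
  refine integral_congr_ae (Eventually.of_forall fun ξ => ?_)
  simp only
  rw [SchwartzMap.smulLeftCLM_apply_apply (by fun_prop), schrodingerSymbol, smul_eq_mul,
    smul_eq_mul, ← mul_assoc, ← Complex.exp_add, real_inner_comm]
  congr 2
  push_cast
  ring

end

/-- The constant `(M / (iπ)) ^ (3 / 2)` of the free Schrödinger kernel. -/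
noncomputable def kernelConst (M : ℝ) : ℂ :=
  (Real.sqrt (M / Real.pi) : ℂ) ^ 3 * Complex.exp (-(Complex.I * (3 * Real.pi / 4)))

theorem conj_cpow_neg_mul_neg_I {p : ℝ} (hp : 0 < p) :
    (starRingEnd ℂ) ((((-p : ℝ) : ℂ) * -Complex.I) ^ (3 / 2 : ℂ))
      = (Real.sqrt p : ℂ) ^ 3 * Complex.exp (-(Complex.I * (3 * Real.pi / 4))) := by
  have e1 : ((-p : ℝ) : ℂ) * -Complex.I = (p : ℂ) * Complex.I := by
    push_cast
    ring
  have e2 : (Real.sqrt p : ℂ) = Complex.exp ((Real.log p / 2 : ℝ) : ℂ) := by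
    rw [← Complex.ofReal_exp, Real.exp_half, Real.exp_log hp]
  rw [e1, Complex.cpow_def_of_ne_zero (by simp [hp.ne']), Complex.log_ofReal_mul hp Complex.I_ne_zero,
    Complex.log_I, e2, ← Complex.exp_nat_mul, ← Complex.exp_add, ← Complex.exp_conj]
  congr 1
  have h2 : (starRingEnd ℂ) (3 / 2 : ℂ) = 3 / 2 := by
    rw [map_div₀, Complex.conj_ofNat, Complex.conj_ofNat]
  have h3 : (starRingEnd ℂ) (Real.pi / 2 : ℂ) = Real.pi / 2 := by
    rw [map_div₀, Complex.conj_ofReal, Complex.conj_ofNat]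
  rw [map_mul, map_add, map_mul, Complex.conj_ofReal, Complex.conj_I, h2, h3]
  push_cast
  ring

/-- The free Schrödinger evolution of the characteristic function of a ball, as the integral of
the kernel over the ball. -/
noncomputable def ballIntegral (x₀ : R3) (r M : ℝ) (x : R3) : ℂ :=
  kernelConst M * ∫ y in Metric.closedBall x₀ r, Complex.exp (Complex.I * M * ‖x - y‖ ^ 2)

theorem continuous_ballIntegral (x₀ : R3) (r M : ℝ) : Continuous (ballIntegral x₀ r M) := by
  refine continuous_const.mul ?_
  exact continuous_parametric_integral_of_continuous (X := R3) (Y := R3)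
    (f := fun x y => Complex.exp (Complex.I * M * ‖x - y‖ ^ 2))
    (by unfold Function.uncurry; fun_prop) (isCompact_closedBall x₀ r)

theorem conj_schwartzPropagator_neg_apply {a t : ℝ} (hat : 0 < a * t) (θ : 𝓢(R3, ℂ)) (y : R3) :
    (starRingEnd ℂ) (schwartzPropagator a (-t) θ y) = kernelConst (1 / (4 * (a * t)))
      * ∫ x : R3, Complex.exp (Complex.I * (1 / (4 * (a * t)) : ℝ) * ‖x - y‖ ^ 2)
        * (starRingEnd ℂ) (θ x) := by
  have e1 : 1 / (4 * Real.pi * (a * -t)) = -(1 / (4 * (a * t)) / Real.pi) := by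
    rw [mul_neg, mul_neg, div_neg, div_div]
    ring_nf
  rw [schwartzPropagator_apply_eq_integral (by rw [mul_neg]; exact (neg_neg_of_pos hat).ne), map_mul,
    e1, show (Module.finrank ℝ R3 / 2 : ℂ) = 3 / 2 by simp,
    conj_cpow_neg_mul_neg_I (div_pos (by positivity) Real.pi_pos), kernelConst, ← integral_conj]
  congr 1
  refine integral_congr_ae (Eventually.of_forall fun x => ?_)
  simp only [map_mul, ← Complex.exp_conj, map_pow, Complex.conj_ofReal, Complex.conj_I]
  rw [norm_sub_rev]
  congr 2
  push_cast
  ring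

theorem memLp_ballChar (x₀ : R3) (r : ℝ) : MemLp (ballChar x₀ r) 2 volume :=
  memLp_indicator_const 2 measurableSet_closedBall 1 (Or.inr measure_closedBall_lt_top.ne)

/-- Fubini: the kernel is unimodular, the ball has finite measure and `θ` is integrable, so the
double integral converges absolutely. -/
theorem inner_schwartzPropagator_ballChar {a t : ℝ} (hat : 0 < a * t) (x₀ : R3) (r : ℝ)
    (θ : 𝓢(R3, ℂ)) :
    ⟪(schwartzPropagator a (-t) θ).toLp 2 volume, (memLp_ballChar x₀ r).toLp _⟫_ℂ
      = ∫ x, (starRingEnd ℂ) (θ x) * ballIntegral x₀ r (1 / (4 * (a * t))) x := by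
  set M := 1 / (4 * (a * t)) with hM
  have h1 : ⟪(schwartzPropagator a (-t) θ).toLp 2 volume, (memLp_ballChar x₀ r).toLp _⟫_ℂ
      = ∫ y in Metric.closedBall x₀ r, (starRingEnd ℂ) (schwartzPropagator a (-t) θ y) := by
    rw [L2.inner_def, ← integral_indicator measurableSet_closedBall]
    refine integral_congr_ae ?_
    filter_upwards [(schwartzPropagator a (-t) θ).coeFn_toLp 2 volume,
      (memLp_ballChar x₀ r).coeFn_toLp] with y hy1 hy2
    rw [hy1, hy2, RCLike.inner_apply, ballChar]
    by_cases hy : y ∈ Metric.closedBall x₀ r <;> simp [hy]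
  have hint : Integrable (Function.uncurry fun y x : R3 =>
      Complex.exp (Complex.I * M * ‖x - y‖ ^ 2) * (starRingEnd ℂ) (θ x))
      ((volume.restrict (Metric.closedBall x₀ r)).prod volume) := by
    have hθ : Integrable (fun z : R3 × R3 => (1 : ℂ) * (starRingEnd ℂ) (θ z.2))
        ((volume.restrict (Metric.closedBall x₀ r)).prod volume) := by
      have : IsFiniteMeasure ((volume : Measure R3).restrict (Metric.closedBall x₀ r)) :=
        isFiniteMeasure_restrict.2 measure_closedBall_lt_top.ne
      have hc : Integrable (fun x => (starRingEnd ℂ) (θ x)) volume :=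
        (LinearIsometryEquiv.integrable_comp_iff Complex.conjLIE).2 (θ.integrable (μ := volume))
      exact (integrable_const (μ := volume.restrict (Metric.closedBall x₀ r)) (1 : ℂ)).mul_prod hc
    refine hθ.mono ?_ (Eventually.of_forall fun z => ?_)
    · refine Continuous.aestronglyMeasurable ?_
      have := θ.continuous
      unfold Function.uncurry
      have h2 := Complex.continuous_conj.comp (this.comp (continuous_snd (X := R3) (Y := R3)))
      exact Continuous.mul (by fun_prop) h2
    · have : Complex.I * M * ((‖z.2 - z.1‖ : ℝ) : ℂ) ^ 2
          = ((M * ‖z.2 - z.1‖ ^ 2 : ℝ) : ℂ) * Complex.I := by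
        push_cast
        ring
      simp only [Function.uncurry, norm_mul]
      rw [this, Complex.norm_exp_ofReal_mul_I]
      simp
  rw [h1]
  simp only [conj_schwartzPropagator_neg_apply hat, ← hM, ballIntegral]
  rw [integral_const_mul, integral_integral_swap hint, ← integral_const_mul]
  refine integral_congr_ae (Eventually.of_forall fun x => ?_)
  simp only
  rw [integral_mul_const]
  ring

/-- Both sides are locally integrable and have the same integral against every real test function,
by duality. -/
theorem schrodingerPropagator_ballChar_ae_eq {a t : ℝ} (hat : 0 < a * t) (x₀ : R3) (r : ℝ) :
    schrodingerPropagator a t ((memLp_ballChar x₀ r).toLp _)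
      =ᵐ[volume] ballIntegral x₀ r (1 / (4 * (a * t))) := by
  refine ae_eq_of_integral_contDiff_smul_eq
    ((Lp.memLp _).locallyIntegrable (by norm_num))
    (continuous_ballIntegral _ _ _).locallyIntegrable fun g hg hgc => ?_
  have h1 : HasCompactSupport (fun x => (g x : ℂ)) :=
    hgc.comp_left (g := fun x : ℝ => (x : ℂ)) (by simp)
  have h2 : ContDiff ℝ ∞ (fun x => (g x : ℂ)) := Complex.ofRealCLM.contDiff.comp hg
  let θ : 𝓢(R3, ℂ) := h1.toSchwartzMap h2
  have hθ : ∀ x, θ x = g x := fun x => rfl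
  have h := inner_schwartzPropagator_ballChar hat x₀ r θ
  rw [← inner_schrodingerPropagator, L2.inner_def] at h
  convert h using 1
  · refine integral_congr_ae ?_
    filter_upwards [θ.coeFn_toLp 2 volume] with x hx
    rw [hx, hθ, RCLike.inner_apply]
    simp [mul_comm]
  · refine integral_congr_ae (Eventually.of_forall fun x => ?_)
    simp [hθ]

end Kernel

/-! ### Evaluating the ball integral by planar slices -/

section Slices

open scoped InnerProductSpace

theorem hasDerivAt_cexp_I_mul_sq (M y : ℝ) :
    HasDerivAt (fun y : ℝ => Complex.exp (Complex.I * M * (y : ℂ) ^ 2))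
      (2 * (Complex.I * M) * y * Complex.exp (Complex.I * M * (y : ℂ) ^ 2)) y := by
  have h := (((hasDerivAt_id (y : ℂ)).pow 2).const_mul (Complex.I * M)).cexp.comp_ofReal
  simp only [id_eq, Pi.pow_apply] at h
  refine h.congr_deriv ?_
  simp only [Nat.cast_ofNat]
  ring

/-- In polar coordinates the area element supplies the factor `y` that makes the radial integrand an
exact derivative. -/
theorem integral_disc_cexp {M : ℝ} (hM : M ≠ 0) {R : ℝ} (hR : 0 ≤ R) :
    ∫ w in Metric.closedBall (0 : EuclideanSpace ℝ (Fin 2)) R,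
        Complex.exp (Complex.I * M * ‖w‖ ^ 2)
      = Real.pi / (Complex.I * M) * (Complex.exp (Complex.I * M * R ^ 2) - 1) := by
  have hM' : (M : ℂ) ≠ 0 := by exact_mod_cast hM
  have h1 : ∫ w in Metric.closedBall (0 : EuclideanSpace ℝ (Fin 2)) R,
        Complex.exp (Complex.I * M * ‖w‖ ^ 2)
      = ∫ w : EuclideanSpace ℝ (Fin 2),
        (Iic R).indicator (fun y : ℝ => Complex.exp (Complex.I * M * y ^ 2)) ‖w‖ := by
    rw [← integral_indicator measurableSet_closedBall]
    refine integral_congr_ae (Eventually.of_forall fun w => ?_)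
    by_cases hw : ‖w‖ ≤ R <;> simp [indicator, hw]
  have h2 : ∫ y in (0 : ℝ)..R, (y : ℂ) * Complex.exp (Complex.I * M * y ^ 2)
      = 1 / (2 * (Complex.I * M)) * (Complex.exp (Complex.I * M * R ^ 2) - 1) := by
    have := intervalIntegral.integral_eq_sub_of_hasDerivAt (a := 0) (b := R)
      (fun y _ => (hasDerivAt_cexp_I_mul_sq M y).const_mul (1 / (2 * (Complex.I * M))))
      (Continuous.intervalIntegrable (by fun_prop) _ _)
    rw [Complex.ofReal_zero, zero_pow two_ne_zero, mul_zero, Complex.exp_zero, ← mul_sub] at this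
    rw [← this]
    refine intervalIntegral.integral_congr fun y _ => ?_
    field_simp
  rw [h1, integral_fun_norm_addHaar volume
    ((Iic R).indicator (fun y : ℝ => Complex.exp (Complex.I * M * y ^ 2)))]
  have h3 : ∫ y in Ioi (0 : ℝ), y ^ (Module.finrank ℝ (EuclideanSpace ℝ (Fin 2)) - 1) •
      (Iic R).indicator (fun y : ℝ => Complex.exp (Complex.I * M * y ^ 2)) y
      = ∫ y in (0 : ℝ)..R, (y : ℂ) * Complex.exp (Complex.I * M * y ^ 2) := by
    rw [intervalIntegral.integral_of_le hR, ← Ioi_inter_Iic,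
      ← setIntegral_indicator measurableSet_Iic]
    refine integral_congr_ae (Eventually.of_forall fun y => ?_)
    by_cases hy : y ≤ R <;> simp [hy, indicator]
  rw [h3, h2, measureReal_def, EuclideanSpace.volume_ball_fin_two]
  simp only [ENNReal.ofReal_one, one_pow, one_mul, ENNReal.toReal_ofReal Real.pi_pos.le,
    finrank_euclideanSpace_fin, Complex.real_smul, nsmul_eq_mul]
  push_cast
  field_simp

/-- The decomposition of three-dimensional space as a line times a plane. -/
noncomputable def lineProdPlane : ℝ × EuclideanSpace ℝ (Fin 2) ≃ᵐ R3 :=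
  ((MeasurableEquiv.refl ℝ).prodCongr (MeasurableEquiv.toLp 2 (Fin 2 → ℝ)).symm).trans
    ((MeasurableEquiv.piFinSuccAbove (fun _ : Fin 3 => ℝ) 0).symm.trans
      (MeasurableEquiv.toLp 2 (Fin 3 → ℝ)))

theorem measurePreserving_lineProdPlane : MeasurePreserving lineProdPlane volume volume := by
  have h1 : MeasurePreserving
      ((MeasurableEquiv.refl ℝ).prodCongr (MeasurableEquiv.toLp 2 (Fin 2 → ℝ)).symm)
      (volume : Measure (ℝ × EuclideanSpace ℝ (Fin 2))) volume :=
    (MeasurePreserving.id volume).prod (PiLp.volume_preserving_ofLp (Fin 2))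
  have h2 := (volume_preserving_piFinSuccAbove (fun _ : Fin 3 => ℝ) 0).symm
  have h3 := PiLp.volume_preserving_toLp (Fin 3)
  exact h3.comp (h2.comp h1)

theorem lineProdPlane_zero (p : ℝ × EuclideanSpace ℝ (Fin 2)) : lineProdPlane p 0 = p.1 := rfl

theorem lineProdPlane_succ (p : ℝ × EuclideanSpace ℝ (Fin 2)) (i : Fin 2) :
    lineProdPlane p i.succ = p.2 i := rfl

theorem norm_single_sub_lineProdPlane_sq (d : ℝ) (p : ℝ × EuclideanSpace ℝ (Fin 2)) :
    ‖EuclideanSpace.single (0 : Fin 3) d - lineProdPlane p‖ ^ 2 = (d - p.1) ^ 2 + ‖p.2‖ ^ 2 := by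
  rw [EuclideanSpace.real_norm_sq_eq, EuclideanSpace.real_norm_sq_eq, Fin.sum_univ_succ]
  simp only [PiLp.sub_apply, lineProdPlane_zero, lineProdPlane_succ]
  simp

theorem exists_linearIsometryEquiv_single (v : R3) :
    ∃ L : R3 ≃ₗᵢ[ℝ] R3, L (EuclideanSpace.single 0 ‖v‖) = v := by
  by_cases hv : v = 0
  · exact ⟨LinearIsometryEquiv.refl ℝ R3, by simp [hv]⟩
  have hon : Orthonormal ℝ (({0} : Set (Fin 3)).domRestrict fun _ : Fin 3 => (‖v‖⁻¹ • v : R3)) := by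
    refine ⟨fun i => ?_, fun i j hij => (hij (Subsingleton.elim i j)).elim⟩
    change ‖‖v‖⁻¹ • v‖ = 1
    rw [norm_smul, norm_inv, norm_norm, inv_mul_cancel₀ (norm_ne_zero_iff.2 hv)]
  obtain ⟨b, hb⟩ := hon.exists_orthonormalBasis_extension_of_card_eq (by simp)
  refine ⟨b.repr.symm, ?_⟩
  have h1 : EuclideanSpace.single (0 : Fin 3) ‖v‖ = ‖v‖ • EuclideanSpace.single (0 : Fin 3) 1 := by
    ext i
    simp
  rw [h1, map_smul, b.repr_symm_single, hb 0 rfl, smul_smul, mul_inv_cancel₀ (by simpa using hv),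
    one_smul]

theorem setIntegral_closedBall_eq_single (x₀ x : R3) (r M : ℝ) :
    ∫ y in Metric.closedBall x₀ r, Complex.exp (Complex.I * M * ‖x - y‖ ^ 2)
      = ∫ z in Metric.closedBall (0 : R3) r,
        Complex.exp (Complex.I * M * ‖EuclideanSpace.single (0 : Fin 3) ‖x - x₀‖ - z‖ ^ 2) := by
  obtain ⟨L, hL⟩ := exists_linearIsometryEquiv_single (x - x₀)
  let e : R3 ≃ᵐ R3 := L.toHomeomorph.toMeasurableEquiv.trans (MeasurableEquiv.addLeft x₀)
  have he : MeasurePreserving e volume volume :=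
    (measurePreserving_add_left volume x₀).comp L.measurePreserving
  have hez : ∀ z, e z = x₀ + L z := fun z => rfl
  rw [← he.setIntegral_preimage_emb e.measurableEmbedding]
  have hpre : e ⁻¹' Metric.closedBall x₀ r = Metric.closedBall 0 r := by
    ext z
    simp [hez]
  rw [hpre]
  refine integral_congr_ae (Eventually.of_forall fun z => ?_)
  simp only
  rw [hez, ← sub_sub, ← hL, ← map_sub, L.norm_map, hL]

/-- The slice at height `s` is a disc of radius `√(r ^ 2 - s ^ 2)`, and by Pythagoras the phase
splits into an axial and a planar factor. -/
theorem setIntegral_closedBall_single {M : ℝ} (hM : M ≠ 0) (d : ℝ) {r : ℝ} (hr : 0 < r) :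
    ∫ z in Metric.closedBall (0 : R3) r,
        Complex.exp (Complex.I * M * ‖EuclideanSpace.single (0 : Fin 3) d - z‖ ^ 2)
      = ∫ s in -r..r, Complex.exp (Complex.I * M * (d - s) ^ 2)
        * (Real.pi / (Complex.I * M) * (Complex.exp (Complex.I * M * (r ^ 2 - s ^ 2)) - 1)) := by
  rw [← measurePreserving_lineProdPlane.setIntegral_preimage_emb
    lineProdPlane.measurableEmbedding]
  have hmem : ∀ p, p ∈ lineProdPlane ⁻¹' Metric.closedBall (0 : R3) r
      ↔ p.1 ^ 2 + ‖p.2‖ ^ 2 ≤ r ^ 2 := fun p => by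
    have := norm_single_sub_lineProdPlane_sq 0 p
    rw [mem_preimage, mem_closedBall_zero_iff, ← abs_of_nonneg (norm_nonneg (lineProdPlane p)),
      ← abs_of_pos hr, ← sq_le_sq, abs_of_pos hr]
    rw [show EuclideanSpace.single (0 : Fin 3) (0 : ℝ) = 0 by ext i; simp, zero_sub, norm_neg,
      zero_sub, neg_sq] at this
    rw [this]
  have hmeas : MeasurableSet (lineProdPlane ⁻¹' Metric.closedBall (0 : R3) r) :=
    lineProdPlane.measurable measurableSet_closedBall
  have hint : IntegrableOn (fun p => Complex.exp (Complex.I * M *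
      ‖EuclideanSpace.single (0 : Fin 3) d - lineProdPlane p‖ ^ 2))
      (lineProdPlane ⁻¹' Metric.closedBall (0 : R3) r) := by
    refine (measurePreserving_lineProdPlane.integrableOn_comp_preimage
      (f := fun z => Complex.exp (Complex.I * M * ‖EuclideanSpace.single (0 : Fin 3) d - z‖ ^ 2))
      lineProdPlane.measurableEmbedding).2 ?_
    exact (Continuous.continuousOn (by fun_prop)).integrableOn_compact (isCompact_closedBall _ _)
  have hslice : ∀ s : ℝ, ∫ w, (lineProdPlane ⁻¹' Metric.closedBall (0 : R3) r).indicator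
      (fun p => Complex.exp (Complex.I * M *
        ‖EuclideanSpace.single (0 : Fin 3) d - lineProdPlane p‖ ^ 2)) (s, w)
      = (Icc (-r) r).indicator (fun s : ℝ => Complex.exp (Complex.I * M * (d - s) ^ 2)
        * (Real.pi / (Complex.I * M) * (Complex.exp (Complex.I * M * (r ^ 2 - s ^ 2)) - 1))) s := by
    intro s
    by_cases hs : s ∈ Icc (-r) r
    · have hs2 : 0 ≤ r ^ 2 - s ^ 2 := sub_nonneg.2 (sq_le_sq' hs.1 hs.2)
      have hcast : (r : ℂ) ^ 2 - (s : ℂ) ^ 2 = (Real.sqrt (r ^ 2 - s ^ 2) : ℂ) ^ 2 := by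
        rw [← Complex.ofReal_pow (Real.sqrt _), Real.sq_sqrt hs2]
        push_cast
        ring
      rw [indicator_of_mem hs, hcast,
        ← integral_disc_cexp hM (Real.sqrt_nonneg _), ← integral_const_mul,
        ← integral_indicator measurableSet_closedBall]
      refine integral_congr_ae (Eventually.of_forall fun w => ?_)
      have hiff : (s, w) ∈ lineProdPlane ⁻¹' Metric.closedBall (0 : R3) r
          ↔ w ∈ Metric.closedBall (0 : EuclideanSpace ℝ (Fin 2)) (Real.sqrt (r ^ 2 - s ^ 2)) := by
        rw [hmem, mem_closedBall_zero_iff, Real.le_sqrt (norm_nonneg _) hs2, le_sub_iff_add_le']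
      have hval : Complex.exp (Complex.I * M *
          ‖EuclideanSpace.single (0 : Fin 3) d - lineProdPlane (s, w)‖ ^ 2)
          = Complex.exp (Complex.I * M * (d - s) ^ 2) * Complex.exp (Complex.I * M * ‖w‖ ^ 2) := by
        rw [← Complex.exp_add, ← Complex.ofReal_pow, norm_single_sub_lineProdPlane_sq]
        congr 1
        push_cast
        ring
      beta_reduce
      by_cases hw : w ∈ Metric.closedBall (0 : EuclideanSpace ℝ (Fin 2)) (Real.sqrt (r ^ 2 - s ^ 2))
      · rw [indicator_of_mem hw, indicator_of_mem (hiff.2 hw), hval]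
      · rw [indicator_of_notMem hw, indicator_of_notMem (fun h => hw (hiff.1 h))]
    · rw [indicator_of_notMem hs]
      refine integral_eq_zero_of_ae (Eventually.of_forall fun w => ?_)
      refine indicator_of_notMem (fun h => hs ?_) _
      rw [hmem] at h
      exact abs_le.1 (abs_le_of_sq_le_sq (by nlinarith [sq_nonneg ‖w‖]) hr.le)
  rw [← integral_indicator hmeas, Measure.volume_eq_prod,
    integral_prod _ ((integrable_indicator_iff hmeas).2 hint)]
  simp only [hslice]
  rw [integral_indicator measurableSet_Icc, integral_Icc_eq_integral_Ioc,
    ← intervalIntegral.integral_of_le (by linarith)]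

theorem cerf_mul_ofReal (c : ℂ) (y : ℝ) :
    cerf (c * y) = 2 / (Real.sqrt Real.pi : ℂ) * (c * ∫ v in (0 : ℝ)..y,
      Complex.exp (-(c * v) ^ 2)) := by
  have h := intervalIntegral.smul_integral_comp_mul_right (a := 0) (b := 1)
    (fun v : ℝ => Complex.exp (-(c * v) ^ 2)) y
  rw [zero_mul, one_mul] at h
  rw [cerf, intervalIntegral.integral_const_mul, ← h, Complex.real_smul]
  simp only [Complex.ofReal_mul, mul_assoc, mul_left_comm]

/-- The direction `e ^ (3πi / 4)`, a square root of `-i`. -/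
theorem cexp_three_pi_div_four_sq :
    Complex.exp (Complex.I * (3 * Real.pi / 4)) ^ 2 = -Complex.I := by
  rw [← Complex.exp_nat_mul]
  have : ((2 : ℕ) : ℂ) * (Complex.I * (3 * Real.pi / 4))
      = Real.pi * Complex.I + Real.pi / 2 * Complex.I := by
    push_cast
    ring
  rw [this, Complex.exp_add, Complex.exp_pi_mul_I, Complex.exp_pi_div_two_mul_I]
  ring

/-- The square of `e ^ (3πi / 4)` is `-i`, so along this ray the Gaussian of the error function
becomes the Fresnel phase. -/
theorem cerf_direction_mul {M : ℝ} (hM : 0 ≤ M) (y : ℝ) :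
    cerf (Complex.exp (Complex.I * (3 * Real.pi / 4)) * Real.sqrt M * y)
      = 2 / (Real.sqrt Real.pi : ℂ) * (Complex.exp (Complex.I * (3 * Real.pi / 4)) * Real.sqrt M
        * ∫ v in (0 : ℝ)..y, Complex.exp (Complex.I * M * v ^ 2)) := by
  rw [cerf_mul_ofReal]
  have e : ∀ v : ℝ, -(Complex.exp (Complex.I * (3 * Real.pi / 4)) * Real.sqrt M * v) ^ 2
      = Complex.I * M * v ^ 2 := fun v => by
    rw [mul_pow, mul_pow, cexp_three_pi_div_four_sq, ← Complex.ofReal_pow (Real.sqrt M),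
      Real.sq_sqrt hM]
    ring
  simp only [e]

theorem intervalIntegrable_cexp_I_mul_sq (M a b : ℝ) :
    IntervalIntegrable (fun v : ℝ => Complex.exp (Complex.I * M * v ^ 2)) volume a b :=
  Continuous.intervalIntegrable (by fun_prop) _ _

/-- In `(d - s) ^ 2 + (r ^ 2 - s ^ 2)` the squares of `s` cancel, leaving a phase linear in `s`. -/
theorem integral_slices {M : ℝ} (d r : ℝ) :
    ∫ s in -r..r, Complex.exp (Complex.I * M * (d - s) ^ 2)
        * (Real.pi / (Complex.I * M) * (Complex.exp (Complex.I * M * (r ^ 2 - s ^ 2)) - 1))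
      = Real.pi / (Complex.I * M) *
        (Complex.exp (Complex.I * M * (d ^ 2 + r ^ 2))
          * (∫ s in -r..r, Complex.exp (-(2 * Complex.I * M * d) * s))
          - ∫ v in (d - r)..(d + r), Complex.exp (Complex.I * M * v ^ 2)) := by
  have h1 : ∫ v in (d - r)..(d + r), Complex.exp (Complex.I * M * v ^ 2)
      = ∫ s in -r..r, Complex.exp (Complex.I * M * (d - s) ^ 2) := by
    have := intervalIntegral.integral_comp_sub_left (a := -r) (b := r)
      (fun v : ℝ => Complex.exp (Complex.I * M * v ^ 2)) d
    rw [sub_neg_eq_add] at this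
    rw [← this]
    simp only [Complex.ofReal_sub]
  rw [h1, ← intervalIntegral.integral_const_mul, ← intervalIntegral.integral_sub
    (Continuous.intervalIntegrable (by fun_prop) _ _)
    (Continuous.intervalIntegrable (by fun_prop) _ _), ← intervalIntegral.integral_const_mul]
  refine intervalIntegral.integral_congr fun s _ => ?_
  have : Complex.exp (Complex.I * M * (d ^ 2 + r ^ 2)) * Complex.exp (-(2 * Complex.I * M * d) * s)
      = Complex.exp (Complex.I * M * (d - s) ^ 2)
        * Complex.exp (Complex.I * M * (r ^ 2 - s ^ 2)) := by
    rw [← Complex.exp_add, ← Complex.exp_add]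
    congr 1
    ring
  simp only [this]
  ring

theorem kernelConst_mul_pi_div {M : ℝ} (hM : 0 < M) :
    kernelConst M * (Real.pi / (Complex.I * M))
      = Complex.exp (Complex.I * (3 * Real.pi / 4)) * Real.sqrt M / Real.sqrt Real.pi := by
  set α := Complex.exp (Complex.I * (3 * Real.pi / 4)) with hα
  have hα0 : α ≠ 0 := Complex.exp_ne_zero _
  have hq : (Real.sqrt M : ℂ) ≠ 0 := by
    exact_mod_cast (Real.sqrt_pos.2 hM).ne'
  have hp : (Real.sqrt Real.pi : ℂ) ≠ 0 := by
    exact_mod_cast (Real.sqrt_pos.2 Real.pi_pos).ne'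
  have hM2 : (M : ℂ) = (Real.sqrt M : ℂ) ^ 2 := by
    rw [← Complex.ofReal_pow, Real.sq_sqrt hM.le]
  have hp2 : (Real.pi : ℂ) = (Real.sqrt Real.pi : ℂ) ^ 2 := by
    rw [← Complex.ofReal_pow, Real.sq_sqrt Real.pi_pos.le]
  have hα2 : α ^ 2 = -Complex.I := cexp_three_pi_div_four_sq
  rw [kernelConst, Complex.exp_neg, ← hα, Real.sqrt_div hM.le, Complex.ofReal_div]
  have e : (Real.pi : ℂ) / (Complex.I * M)
      = (Real.sqrt Real.pi : ℂ) ^ 2 / (Complex.I * (Real.sqrt M : ℂ) ^ 2) := by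
    rw [← hM2, ← hp2]
  rw [e]
  field_simp
  rw [hα2]
  simp

/-- The linear exponential is left unintegrated to avoid dividing by the distance; so this form
includes the centre. -/
theorem ballIntegral_eq {M : ℝ} (hM : 0 < M) {r : ℝ} (hr : 0 < r) (x₀ x : R3) :
    ballIntegral x₀ r M x
      = Complex.exp (Complex.I * (3 * Real.pi / 4)) * Real.sqrt M / Real.sqrt Real.pi *
        (Complex.exp (Complex.I * M * ((‖x - x₀‖ : ℂ) ^ 2 + r ^ 2))
          * (∫ s in -r..r, Complex.exp (-(2 * Complex.I * M * ‖x - x₀‖) * s))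
          - ∫ v in (‖x - x₀‖ - r)..(‖x - x₀‖ + r), Complex.exp (Complex.I * M * v ^ 2)) := by
  rw [ballIntegral, setIntegral_closedBall_eq_single, setIntegral_closedBall_single hM.ne' _ hr,
    integral_slices, ← mul_assoc, kernelConst_mul_pi_div hM]

theorem ballIntegral_eq_schrodingerProfile {M : ℝ} (hM : 0 < M) {r : ℝ} (hr : 0 < r) {x₀ x : R3}
    (hx : x ≠ x₀) : ballIntegral x₀ r M x = schrodingerProfile M r ‖x - x₀‖ := by
  have hd : (‖x - x₀‖ : ℂ) ≠ 0 := by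
    exact_mod_cast norm_ne_zero_iff.2 (sub_ne_zero.2 hx)
  rw [ballIntegral_eq hM hr]
  set d := ‖x - x₀‖
  have hI := Complex.I_ne_zero
  have hMc : (M : ℂ) ≠ 0 := by exact_mod_cast hM.ne'
  rw [integral_exp_mul_complex (by simp [hd, hMc]), schrodingerProfile,
    ← Complex.ofReal_sub, ← Complex.ofReal_add, cerf_direction_mul hM.le, cerf_direction_mul hM.le,
    ← intervalIntegral.integral_interval_sub_left (intervalIntegrable_cexp_I_mul_sq M 0 (d + r))
      (intervalIntegrable_cexp_I_mul_sq M 0 (d - r))]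
  set A := ∫ v in (0 : ℝ)..(d + r), Complex.exp (Complex.I * M * v ^ 2)
  set B := ∫ v in (0 : ℝ)..(d - r), Complex.exp (Complex.I * M * v ^ 2)
  have e1 : Complex.exp (Complex.I * M * ((d : ℂ) ^ 2 + r ^ 2))
      * Complex.exp (-(2 * Complex.I * M * d) * r)
      = Complex.exp (Complex.I * M * ((d - r : ℝ) : ℂ) ^ 2) := by
    rw [← Complex.exp_add]
    congr 1
    push_cast
    ring
  have e2 : Complex.exp (Complex.I * M * ((d : ℂ) ^ 2 + r ^ 2))
      * Complex.exp (-(2 * Complex.I * M * d) * (-r : ℝ))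
      = Complex.exp (Complex.I * M * ((d + r : ℝ) : ℂ) ^ 2) := by
    rw [← Complex.exp_add]
    congr 1
    push_cast
    ring
  rw [← mul_div_assoc (Complex.exp (Complex.I * M * ((d : ℂ) ^ 2 + r ^ 2))),
    mul_sub (Complex.exp (Complex.I * M * ((d : ℂ) ^ 2 + r ^ 2))), e1, e2, Complex.exp_neg]
  set α := Complex.exp (Complex.I * (3 * Real.pi / 4)) with hα
  set X := Complex.exp (Complex.I * M * ((d - r : ℝ) : ℂ) ^ 2)
  set Y := Complex.exp (Complex.I * M * ((d + r : ℝ) : ℂ) ^ 2)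
  have hα0 : α ≠ 0 := Complex.exp_ne_zero _
  have hα2 : α ^ 2 = -Complex.I := cexp_three_pi_div_four_sq
  have hq : (Real.sqrt M : ℂ) ≠ 0 := by
    exact_mod_cast (Real.sqrt_pos.2 hM).ne'
  have hp : (Real.sqrt Real.pi : ℂ) ≠ 0 := by
    exact_mod_cast (Real.sqrt_pos.2 Real.pi_pos).ne'
  have hM2 : (M : ℂ) = (Real.sqrt M : ℂ) ^ 2 := by
    rw [← Complex.ofReal_pow, Real.sq_sqrt hM.le]
  -- As `α ^ 2 = -i`, the quotient `α / (-i)` is `α⁻¹`.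
  have key : α * Real.sqrt M / Real.sqrt Real.pi * ((X - Y) / -(2 * Complex.I * M * d))
      = α⁻¹ * (X - Y) / (2 * Real.sqrt M * d * Real.sqrt Real.pi) := by
    rw [hM2]
    field_simp
    rw [hα2]
    ring
  rw [mul_sub, key]
  ring

/-- At distance zero the linear exponential integrates to `2 r`, and the Fresnel integrand is even.
-/
theorem ballIntegral_self {M : ℝ} (hM : 0 < M) {r : ℝ} (hr : 0 < r) (x₀ : R3) :
    ballIntegral x₀ r M x₀ = schrodingerCentre M r := by
  rw [ballIntegral_eq hM hr, sub_self, norm_zero, schrodingerCentre, cerf_direction_mul hM.le,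
    zero_sub, zero_add]
  have h1 : ∫ v in (-r)..r, Complex.exp (Complex.I * M * v ^ 2)
      = 2 * ∫ v in (0 : ℝ)..r, Complex.exp (Complex.I * M * v ^ 2) := by
    have h2 := intervalIntegral.integral_comp_neg (a := -r) (b := 0)
      (fun v : ℝ => Complex.exp (Complex.I * M * v ^ 2))
    rw [neg_neg, neg_zero] at h2
    rw [← intervalIntegral.integral_add_adjacent_intervals
      (intervalIntegrable_cexp_I_mul_sq M (-r) 0) (intervalIntegrable_cexp_I_mul_sq M 0 r), two_mul,
      ← h2]
    simp only [Complex.ofReal_neg, neg_sq]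
  rw [h1]
  simp
  ring

/-- No expansion in `d` is needed: along an axis the profile is the restriction of the continuous
`ballIntegral`. -/
theorem tendsto_schrodingerProfile {M : ℝ} (hM : 0 < M) {r : ℝ} (hr : 0 < r) :
    Tendsto (schrodingerProfile M r) (𝓝[>] 0) (𝓝 (schrodingerCentre M r)) := by
  have hc : Continuous fun d : ℝ => ballIntegral 0 r M (EuclideanSpace.single (0 : Fin 3) d) := by
    have hs : ∀ d : ℝ, EuclideanSpace.single (0 : Fin 3) d
        = d • EuclideanSpace.single (0 : Fin 3) (1 : ℝ) := fun d => by ext i; simp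
    rw [show (fun d : ℝ => ballIntegral 0 r M (EuclideanSpace.single (0 : Fin 3) d))
      = fun d : ℝ => ballIntegral 0 r M (d • EuclideanSpace.single (0 : Fin 3) (1 : ℝ)) from
      funext fun d => by rw [hs d]]
    exact (continuous_ballIntegral 0 r M).comp (by fun_prop)
  have h0 : EuclideanSpace.single (0 : Fin 3) (0 : ℝ) = 0 := by ext i; simp
  have h := (hc.tendsto 0).mono_left (nhdsWithin_le_nhds (s := Ioi 0))
  rw [h0, ballIntegral_self hM hr] at h
  refine h.congr' ?_
  filter_upwards [self_mem_nhdsWithin] with d hd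
  have hd' : (0 : ℝ) < d := hd
  have hne : EuclideanSpace.single (0 : Fin 3) d ≠ 0 := by
    simpa using hd'.ne'
  rw [ballIntegral_eq_schrodingerProfile hM hr hne, sub_zero, PiLp.norm_single,
    Real.norm_of_nonneg hd'.le]

end Slices

/-! ### Smoothness and the pointwise equation -/

section ClassicalSolution

/-- Joint continuity of `F'` bounds it on a compact time interval times `K`, and that constant
dominates. -/
theorem hasDerivAt_setIntegral_of_isCompact {Y : Type*} [TopologicalSpace Y] [MeasurableSpace Y]
    [OpensMeasurableSpace Y] [T2Space Y] {μ : Measure Y} [IsFiniteMeasureOnCompacts μ] {K : Set Y}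
    (hK : IsCompact K) {U : Set ℝ} (hU : IsOpen U) {F F' : ℝ → Y → ℂ}
    (hF : ∀ s ∈ U, ContinuousOn (F s) K) (hF' : ContinuousOn (Function.uncurry F') (U ×ˢ K))
    (h : ∀ s ∈ U, ∀ y ∈ K, HasDerivAt (fun s => F s y) (F' s y) s) {s : ℝ} (hs : s ∈ U) :
    HasDerivAt (fun s => ∫ y in K, F s y ∂μ) (∫ y in K, F' s y ∂μ) s := by
  obtain ⟨ε, hε, hεU⟩ := Metric.nhds_basis_closedBall.mem_iff.1 (hU.mem_nhds hs)
  have hcomp : IsCompact (Metric.closedBall s ε ×ˢ K) := (isCompact_closedBall s ε).prod hK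
  obtain ⟨C, hC⟩ := hcomp.exists_bound_of_continuousOn
    (hF'.mono (prod_mono hεU Subset.rfl))
  have hslice : ContinuousOn (F' s) K :=
    hF'.comp (f := fun y => (s, y)) (by fun_prop) fun y hy => ⟨hs, hy⟩
  refine (hasDerivAt_integral_of_dominated_loc_of_deriv_le (bound := fun _ => C)
    (Metric.ball_mem_nhds s hε) ?_ ((hF s hs).integrableOn_compact hK)
    (hslice.aestronglyMeasurable_of_isCompact hK hK.measurableSet) ?_ ?_ ?_).2
  · filter_upwards [hU.mem_nhds hs] with s' hs'
    exact (hF s' hs').aestronglyMeasurable_of_isCompact hK hK.measurableSet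
  · refine (ae_restrict_iff' hK.measurableSet).2 (Eventually.of_forall fun y hy s' hs' => ?_)
    exact hC (s', y) ⟨Metric.ball_subset_closedBall hs', hy⟩
  · exact integrableOn_const hK.measure_ne_top
  · refine (ae_restrict_iff' hK.measurableSet).2 (Eventually.of_forall fun y hy s' hs' => ?_)
    exact h s' (hεU (Metric.ball_subset_closedBall hs')) y hy

theorem laplacian_eq_sum_of_hasDerivAt {ι V : Type*} [Fintype ι] [NormedAddCommGroup V]
    [InnerProductSpace ℝ V] [FiniteDimensional ℝ V] {f : V → ℂ} (hf : ContDiff ℝ 2 f)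
    (b : OrthonormalBasis ι ℝ V) {x : V} {g : ι → ℝ → ℂ} {l : ι → ℂ}
    (h1 : ∀ i s, HasDerivAt (fun s : ℝ => f (x + s • b i)) (g i s) s)
    (h2 : ∀ i, HasDerivAt (g i) (l i) 0) : Δ f x = ∑ i, l i := by
  rw [InnerProductSpace.laplacian_eq_iteratedFDeriv_orthonormalBasis f b]
  refine Finset.sum_congr rfl fun i _ => ?_
  rw [iteratedFDeriv_two_apply]
  have hline : ∀ s : ℝ, HasDerivAt (fun s : ℝ => x + s • b i) (b i) s := fun s => by
    simpa using ((hasDerivAt_id s).smul_const (b i)).const_add x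
  have hg : g i = fun s => fderiv ℝ f (x + s • b i) (b i) := funext fun s =>
    (h1 i s).unique
      (((hf.differentiable (by norm_num)) (x + s • b i)).hasFDerivAt.comp_hasDerivAt s (hline s))
  have hd : Differentiable ℝ (fderiv ℝ f) :=
    (hf.fderiv_right (m := 1) (by norm_num)).differentiable (by norm_num)
  have h3 := (hd (x + (0 : ℝ) • b i)).hasFDerivAt.comp_hasDerivAt 0 (hline 0)
  have h4 := h3.clm_apply (hasDerivAt_const (0 : ℝ) (b i))
  have h5 := h2 i
  rw [hg] at h5
  have := h5.unique h4
  rw [this]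
  simp

/-- The integral is a convolution of the indicator with a smooth kernel depending on the parameter
`(t, x)`, evaluated at the origin. -/
theorem contDiffOn_ballIntegral (x₀ : R3) (r : ℝ) {c : ℝ} (hc : 0 < c) :
    ContDiffOn ℝ ∞ (fun p : ℝ × R3 => ballIntegral x₀ r (c / p.1) p.2) (Ioi 0 ×ˢ univ) := by
  have hq : ContDiffOn ℝ ∞ (fun p : ℝ × R3 => c / p.1) (Ioi 0 ×ˢ univ) :=
    contDiffOn_const.div contDiff_fst.contDiffOn fun p hp => (ne_of_gt hp.1)
  have hk : ContDiffOn ℝ ∞ (fun p : ℝ × R3 => kernelConst (c / p.1)) (Ioi 0 ×ˢ univ) := by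
    have h1 : ContDiffOn ℝ ∞ (fun p : ℝ × R3 => Real.sqrt (c / p.1 / Real.pi)) (Ioi 0 ×ˢ univ) :=
      (hq.div_const _).sqrt fun p hp => (div_pos (div_pos hc hp.1) Real.pi_pos).ne'
    exact ((Complex.ofRealCLM.contDiff.comp_contDiffOn h1).pow 3).mul contDiffOn_const
  -- The convolution theorem needs a compactly supported kernel. Evaluation at the origin puts `z =
  -- -y`, and the inner radius makes `χ (-y) = 1` for every `y` in the ball.
  let χ : ContDiffBump (0 : R3) := ⟨‖x₀‖ + |r| + 1, ‖x₀‖ + |r| + 2, by positivity, by linarith⟩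
  let g : ℝ × R3 → R3 → ℂ := fun p z =>
    Complex.exp (Complex.I * (c / p.1 : ℝ) * ‖p.2 + z‖ ^ 2) * χ z
  have hg : ContDiffOn ℝ ∞ (Function.uncurry g) ((Ioi 0 ×ˢ univ) ×ˢ univ) := by
    have h1 : ContDiffOn ℝ ∞ (fun q : (ℝ × R3) × R3 => c / q.1.1) ((Ioi 0 ×ˢ univ) ×ˢ univ) :=
      hq.comp contDiff_fst.contDiffOn fun q hq => hq.1
    have h2 : ContDiff ℝ ∞ (fun q : (ℝ × R3) × R3 => ‖q.1.2 + q.2‖ ^ 2) :=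
      (contDiff_fst.snd.add contDiff_snd).norm_sq ℝ
    have h3 : ContDiff ℝ ∞ (fun q : (ℝ × R3) × R3 => (χ q.2 : ℂ)) :=
      Complex.ofRealCLM.contDiff.comp (χ.contDiff.comp contDiff_snd)
    have h4 : ContDiffOn ℝ ∞ (fun q : (ℝ × R3) × R3 =>
        Complex.I * ((c / q.1.1 * ‖q.1.2 + q.2‖ ^ 2 : ℝ) : ℂ)) ((Ioi 0 ×ˢ univ) ×ˢ univ) :=
      contDiffOn_const.mul (Complex.ofRealCLM.contDiff.comp_contDiffOn (h1.mul h2.contDiffOn))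
    refine (h4.cexp.mul h3.contDiffOn).congr fun q _ => ?_
    simp only [Function.uncurry, g]
    push_cast
    rw [mul_assoc]
  have hf : LocallyIntegrable (ballChar x₀ r) volume :=
    (memLp_ballChar x₀ r).locallyIntegrable (by norm_num)
  have hconv := contDiffOn_convolution_right_with_param (μ := volume) (n := ⊤)
    (f := ballChar x₀ r) (g := g) (ContinuousLinearMap.mul ℝ ℂ)
    (isOpen_Ioi.prod isOpen_univ) χ.hasCompactSupport
    (fun p z _ hz => by simp [g, image_eq_zero_of_notMem_tsupport hz]) hf hg
  have hcomp := hconv.comp (f := fun p : ℝ × R3 => (p, (0 : R3))) (s := Ioi 0 ×ˢ univ)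
    (contDiff_id.prodMk contDiff_const).contDiffOn fun p hp => ⟨hp, mem_univ _⟩
  refine hk.mul (hcomp.congr fun p hp => ?_)
  simp only [Function.comp_apply, convolution, ContinuousLinearMap.mul_apply']
  rw [← integral_indicator measurableSet_closedBall]
  refine integral_congr_ae (Eventually.of_forall fun y => ?_)
  by_cases hy : y ∈ Metric.closedBall x₀ r
  · have hχ : χ (-y) = 1 := χ.one_of_mem_closedBall (by
      rw [mem_closedBall_zero_iff, norm_neg]
      have h1 := norm_le_of_mem_closedBall hy
      have h2 := le_abs_self r
      change ‖y‖ ≤ ‖x₀‖ + |r| + 1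
      linarith)
    simp [ballChar, hy, g, hχ, sub_eq_add_neg]
  · simp [ballChar, hy]

theorem hasDerivAt_kernelConst {c t : ℝ} (hc : 0 < c) (ht : 0 < t) :
    HasDerivAt (fun t => kernelConst (c / t)) (-(3 / (2 * t)) * kernelConst (c / t)) t := by
  have hf : 0 < c / t / Real.pi := div_pos (div_pos hc ht) Real.pi_pos
  have hs := Real.sqrt_pos.2 hf
  have h1 : HasDerivAt (fun t : ℝ => c / t / Real.pi) (-(c / t / Real.pi) / t) t := by
    have := ((hasDerivAt_inv ht.ne').const_mul c).div_const Real.pi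
    simp only [← div_eq_mul_inv] at this
    refine this.congr_deriv ?_
    field_simp
  have h2 := (h1.sqrt hf.ne').ofReal_comp
  have h3 := (h2.pow 3).mul_const (Complex.exp (-(Complex.I * (3 * Real.pi / 4))))
  refine h3.congr_deriv ?_
  have e : -(c / t / Real.pi) / t / (2 * Real.sqrt (c / t / Real.pi))
      = -Real.sqrt (c / t / Real.pi) / (2 * t) := by
    rw [div_div, div_eq_div_iff (by positivity) (by positivity)]
    nlinarith [Real.mul_self_sqrt hf.le]
  rw [e, kernelConst]
  push_cast
  field_simp

/-- The integrand of the evolution at time `t` of a ball, with `M = c / t`. -/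
noncomputable def freeKernel (c t : ℝ) (z : R3) : ℂ :=
  kernelConst (c / t) * Complex.exp (Complex.I * (c / t : ℝ) * ‖z‖ ^ 2)

theorem ballIntegral_eq_setIntegral_freeKernel (x₀ : R3) (r c t : ℝ) (x : R3) :
    ballIntegral x₀ r (c / t) x = ∫ y in Metric.closedBall x₀ r, freeKernel c t (x - y) := by
  simp only [freeKernel]
  rw [integral_const_mul, ballIntegral]

theorem hasDerivAt_freeKernel {c t : ℝ} (hc : 0 < c) (ht : 0 < t) (z : R3) :
    HasDerivAt (fun t => freeKernel c t z)
      (-(1 / t) * (3 / 2 + Complex.I * (c / t : ℝ) * ‖z‖ ^ 2) * freeKernel c t z) t := by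
  have h1 : HasDerivAt (fun t : ℝ => ((c / t : ℝ) : ℂ)) ((-(c / t) / t : ℝ) : ℂ) t := by
    have := ((hasDerivAt_inv ht.ne').const_mul c)
    simp only [← div_eq_mul_inv] at this
    refine HasDerivAt.ofReal_comp (this.congr_deriv ?_)
    field_simp
  have h2 := (hasDerivAt_kernelConst hc ht).mul
    ((h1.const_mul Complex.I).mul_const ((‖z‖ : ℂ) ^ 2)).cexp
  refine h2.congr_deriv ?_
  have ht' : (t : ℂ) ≠ 0 := by exact_mod_cast ht.ne'
  simp only [freeKernel]
  push_cast
  field_simp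
  ring

theorem hasDerivAt_freeKernel_line (c t : ℝ) (z e : R3) (he : ‖e‖ = 1) (s : ℝ) :
    HasDerivAt (fun s : ℝ => freeKernel c t (z + s • e))
      (2 * Complex.I * (c / t : ℝ) * (inner ℝ z e + s : ℝ) * freeKernel c t (z + s • e)) s := by
  have hn : ∀ s : ℝ, ‖z + s • e‖ ^ 2 = ‖z‖ ^ 2 + 2 * s * inner ℝ z e + s ^ 2 := fun s => by
    rw [norm_add_sq_real, inner_smul_right, norm_smul, he, mul_one, Real.norm_eq_abs, sq_abs]
    ring
  have h1 : HasDerivAt (fun s : ℝ => ‖z + s • e‖ ^ 2) (2 * (inner ℝ z e + s)) s := by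
    simp only [hn]
    have h := (((hasDerivAt_id s).const_mul 2).mul_const (inner ℝ z e)).const_add (‖z‖ ^ 2)
    refine (h.add ((hasDerivAt_id s).pow 2)).congr_deriv ?_
    simp
    ring
  have h2 := ((h1.ofReal_comp.const_mul (Complex.I * (c / t : ℝ))).cexp).const_mul
    (kernelConst (c / t))
  simp only [Complex.ofReal_pow] at h2
  refine h2.congr_deriv ?_
  simp only [freeKernel]
  push_cast
  ring

theorem hasDerivAt_freeKernel_line_deriv (c t : ℝ) (z e : R3) (he : ‖e‖ = 1) (s : ℝ) :
    HasDerivAt (fun s : ℝ =>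
        2 * Complex.I * (c / t : ℝ) * (inner ℝ z e + s : ℝ) * freeKernel c t (z + s • e))
      ((2 * Complex.I * (c / t : ℝ) - 4 * (c / t : ℝ) ^ 2 * (inner ℝ z e + s : ℝ) ^ 2)
        * freeKernel c t (z + s • e)) s := by
  have h1 : HasDerivAt (fun s : ℝ => ((inner ℝ z e + s : ℝ) : ℂ)) ((1 : ℝ) : ℂ) s :=
    ((hasDerivAt_id s).const_add _).ofReal_comp
  refine ((h1.const_mul (2 * Complex.I * (c / t : ℝ))).mul
    (hasDerivAt_freeKernel_line c t z e he s)).congr_deriv ?_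
  push_cast
  ring_nf
  rw [Complex.I_sq]
  ring

theorem continuous_freeKernel (c t : ℝ) : Continuous (freeKernel c t) := by
  unfold freeKernel
  fun_prop

/-- Second derivatives along the three axes are taken under the integral: the term `2 i M` appears
three times, and Parseval sums the squared coordinates of `x - y`. -/
theorem laplacian_ballIntegral (x₀ : R3) (r : ℝ) {c t : ℝ} (hc : 0 < c) (ht : 0 < t) (x : R3) :
    Δ (ballIntegral x₀ r (c / t)) x = ∫ y in Metric.closedBall x₀ r,
      (6 * Complex.I * (c / t : ℝ) - 4 * (c / t : ℝ) ^ 2 * ‖x - y‖ ^ 2)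
        * freeKernel c t (x - y) := by
  have hcd : ContDiff ℝ 2 (ballIntegral x₀ r (c / t)) := by
    rw [← contDiffOn_univ]
    exact (contDiffOn_infty.1 (contDiffOn_ballIntegral x₀ r hc) 2).comp
      (f := fun x : R3 => (t, x)) (contDiff_const.prodMk contDiff_id).contDiffOn
      fun x _ => ⟨ht, mem_univ _⟩
  let b := EuclideanSpace.basisFun (Fin 3) ℝ
  have hb : ∀ i, ‖b i‖ = 1 := b.orthonormal.1
  have hcont : ∀ i, Continuous fun q : ℝ × R3 => freeKernel c t (x - q.2 + q.1 • b i) := fun i =>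
    (continuous_freeKernel c t).comp (by fun_prop)
  have hsub : ∀ (y : R3) (s : ℝ) (i : Fin 3), x + s • b i - y = x - y + s • b i := fun y s i => by
    abel
  rw [laplacian_eq_sum_of_hasDerivAt hcd b
    (g := fun i s => ∫ y in Metric.closedBall x₀ r, 2 * Complex.I * (c / t : ℝ)
      * (inner ℝ (x - y) (b i) + s : ℝ) * freeKernel c t (x - y + s • b i))
    (l := fun i => ∫ y in Metric.closedBall x₀ r, (2 * Complex.I * (c / t : ℝ)
      - 4 * (c / t : ℝ) ^ 2 * (inner ℝ (x - y) (b i) + (0 : ℝ) : ℝ) ^ 2)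
        * freeKernel c t (x - y + (0 : ℝ) • b i))]
  · rw [← integral_finsetSum]
    · refine integral_congr_ae (Eventually.of_forall fun y => ?_)
      have hsum : (‖x - y‖ : ℂ) ^ 2 = ∑ i, ((inner ℝ (x - y) (b i) : ℝ) : ℂ) ^ 2 := by
        rw [← Complex.ofReal_pow, ← b.sum_sq_inner_left]
        push_cast
        rfl
      simp only [zero_smul, add_zero]
      rw [hsum, Finset.mul_sum, ← Finset.sum_mul, Finset.sum_sub_distrib, Finset.sum_const,
        Finset.card_univ, Fintype.card_fin, nsmul_eq_mul]
      push_cast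
      ring
    · intro i _
      refine ContinuousOn.integrableOn_compact (isCompact_closedBall _ _) ?_
      refine Continuous.continuousOn (Continuous.mul (by fun_prop) ?_)
      exact (continuous_freeKernel c t).comp (by fun_prop)
  · intro i s
    simp only [ballIntegral_eq_setIntegral_freeKernel, hsub]
    refine hasDerivAt_setIntegral_of_isCompact (isCompact_closedBall x₀ r) isOpen_univ
      (F := fun s y => freeKernel c t (x - y + s • b i))
      (F' := fun s y => 2 * Complex.I * (c / t : ℝ)
      * (inner ℝ (x - y) (b i) + s : ℝ) * freeKernel c t (x - y + s • b i))
      (fun s _ => ?_) ?_ (fun s _ y _ => hasDerivAt_freeKernel_line c t _ _ (hb i) s) (mem_univ s)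
    · exact ((continuous_freeKernel c t).comp (by fun_prop)).continuousOn
    · exact (Continuous.mul (by fun_prop) (hcont i)).continuousOn
  · intro i
    refine hasDerivAt_setIntegral_of_isCompact (isCompact_closedBall x₀ r) isOpen_univ
      (F := fun s y => 2 * Complex.I * (c / t : ℝ)
      * (inner ℝ (x - y) (b i) + s : ℝ) * freeKernel c t (x - y + s • b i))
      (F' := fun s y => (2 * Complex.I * (c / t : ℝ)
      - 4 * (c / t : ℝ) ^ 2 * (inner ℝ (x - y) (b i) + s : ℝ) ^ 2)
        * freeKernel c t (x - y + s • b i))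
      (fun s _ => ?_) ?_ (fun s _ y _ => hasDerivAt_freeKernel_line_deriv c t _ _ (hb i) s)
      (mem_univ 0)
    · exact (Continuous.mul (by fun_prop)
        ((continuous_freeKernel c t).comp (by fun_prop))).continuousOn
    · exact (Continuous.mul (by fun_prop) (hcont i)).continuousOn

theorem hasDerivAt_ballIntegral (x₀ : R3) (r : ℝ) {c t : ℝ} (hc : 0 < c) (ht : 0 < t) (x : R3) :
    HasDerivAt (fun t => ballIntegral x₀ r (c / t) x)
      (∫ y in Metric.closedBall x₀ r,
        -(1 / t) * (3 / 2 + Complex.I * (c / t : ℝ) * ‖x - y‖ ^ 2) * freeKernel c t (x - y)) t := by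
  simp only [ballIntegral_eq_setIntegral_freeKernel]
  have hk : ContinuousOn (fun t => kernelConst (c / t)) (Ioi 0) := fun t ht =>
    (hasDerivAt_kernelConst hc ht).continuousAt.continuousWithinAt
  have hq : ContinuousOn (fun t : ℝ => c / t) (Ioi 0) :=
    continuousOn_const.div continuousOn_id fun t ht => ne_of_gt ht
  have hi : ContinuousOn (fun t : ℝ => 1 / (t : ℂ)) (Ioi 0) :=
    continuousOn_const.div Complex.continuous_ofReal.continuousOn fun t ht => by
      exact_mod_cast ne_of_gt ht
  have hfst : MapsTo (Prod.fst : ℝ × R3 → ℝ) (Ioi 0 ×ˢ Metric.closedBall x₀ r) (Ioi 0) :=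
    fun q hq => hq.1
  refine hasDerivAt_setIntegral_of_isCompact (isCompact_closedBall x₀ r) isOpen_Ioi
    (F := fun t y => freeKernel c t (x - y))
    (F' := fun t y =>
      -(1 / t) * (3 / 2 + Complex.I * (c / t : ℝ) * ‖x - y‖ ^ 2) * freeKernel c t (x - y))
    (fun s _ => ?_) ?_ (fun s hs y _ => hasDerivAt_freeKernel hc hs _) ht
  · exact ((continuous_freeKernel c s).comp (by fun_prop)).continuousOn
  · have hq' := Complex.continuous_ofReal.comp_continuousOn
      (hq.comp continuous_fst.continuousOn hfst)
    have hk' := hk.comp continuous_fst.continuousOn hfst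
    have hi' := hi.comp continuous_fst.continuousOn hfst
    have hn : ContinuousOn (fun q : ℝ × R3 => (‖x - q.2‖ : ℂ) ^ 2)
        (Ioi 0 ×ˢ Metric.closedBall x₀ r) := Continuous.continuousOn (by fun_prop)
    have hIq := ((continuousOn_const (c := Complex.I)).mul hq').mul hn
    exact (hi'.neg.mul ((continuousOn_const (c := (3 / 2 : ℂ))).add hIq)).mul (hk'.mul hIq.cexp)

/-- The two integrands agree pointwise: with `c = 1 / (4 a)` the kernel itself solves the equation.
-/
theorem deriv_ballIntegral_eq_laplacian (x₀ : R3) (r : ℝ) {a t : ℝ} (ha : 0 < a) (ht : 0 < t)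
    (x : R3) :
    deriv (fun t => ballIntegral x₀ r (1 / (4 * a) / t) x) t
      = Complex.I * a * Δ (ballIntegral x₀ r (1 / (4 * a) / t)) x := by
  have hc : 0 < 1 / (4 * a) := by positivity
  rw [(hasDerivAt_ballIntegral x₀ r hc ht x).deriv, laplacian_ballIntegral x₀ r hc ht x,
    ← integral_const_mul]
  refine integral_congr_ae (Eventually.of_forall fun y => ?_)
  have ht' : (t : ℂ) ≠ 0 := by exact_mod_cast ht.ne'
  have ha' : (a : ℂ) ≠ 0 := by exact_mod_cast ha.ne'
  simp only
  rw [← mul_assoc]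
  congr 1
  push_cast
  field_simp
  ring_nf
  rw [Complex.I_sq]
  ring

end ClassicalSolution

/-! ### From L² curves to the Cauchy problem -/

section CauchyProblem

open scoped SchwartzMap InnerProductSpace

theorem inner_toLp_eq_integral {V : Type*} [NormedAddCommGroup V] [InnerProductSpace ℝ V]
    [FiniteDimensional ℝ V] [MeasurableSpace V] [BorelSpace V] (θ : 𝓢(V, ℂ))
    {G : Lp ℂ 2 (volume : Measure V)} {g : V → ℂ} (h : g =ᵐ[volume] G) :
    ⟪θ.toLp 2 volume, G⟫_ℂ = ∫ x, g x * (starRingEnd ℂ) (θ x) := by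
  rw [L2.inner_def]
  refine integral_congr_ae ?_
  filter_upwards [θ.coeFn_toLp 2 volume, h] with x h1 h2
  rw [h1, h2, RCLike.inner_apply]

/-- The weak formulation pairs without conjugation and the L² inner product with it, so test
functions are conjugated in passing between them. -/
theorem laplacian_conj {V : Type*} [NormedAddCommGroup V] [InnerProductSpace ℝ V]
    [FiniteDimensional ℝ V] {f : V → ℂ} (hf : ContDiff ℝ 2 f) (x : V) :
    Δ (fun y => (starRingEnd ℂ) (f y)) x = (starRingEnd ℂ) (Δ f x) :=
  hf.contDiffAt.laplacian_CLM_comp_left (l := (Complex.conjCLE : ℂ →L[ℝ] ℂ))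

theorem isL2FreeSchrodinger_of_ae_eq_schrodingerPropagator {ħ m : ℝ} (hm : 0 < m)
    {f : R3 → ℂ} {u : ℝ → R3 → ℂ} {g : Lp ℂ 2 (volume : Measure R3)} (h0 : u 0 =ᵐ[volume] f)
    (hu : ∀ t, 0 ≤ t → u t =ᵐ[volume] schrodingerPropagator (ħ / (2 * m)) t g) :
    IsL2FreeSchrodinger ħ m f u where
  memLp t ht := (memLp_congr_ae (hu t ht)).2 (Lp.memLp _)
  continuous_L2 t₀ ht₀ := by
    have h := ((continuous_schrodingerPropagator (ħ / (2 * m)) g).tendsto t₀).sub_const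
      (schrodingerPropagator (ħ / (2 * m)) t₀ g)
    rw [sub_self] at h
    have h1 := ((continuous_enorm.tendsto _).comp h).mono_left
      (nhdsWithin_le_nhds (s := Ici 0))
    rw [enorm_zero] at h1
    refine h1.congr' ?_
    filter_upwards [self_mem_nhdsWithin] with t ht
    rw [Function.comp_apply, Lp.enorm_def]
    refine eLpNorm_congr_ae ((Lp.coeFn_sub _ _).trans ?_)
    exact (hu t ht).symm.sub (hu t₀ ht₀).symm
  initial := h0
  weak φ hφ hφc t ht := by
    have hc1 : HasCompactSupport (fun x => (starRingEnd ℂ) (φ x)) :=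
      hφc.comp_left (g := starRingEnd ℂ) (map_zero _)
    have hc2 : ContDiff ℝ ∞ (fun x => (starRingEnd ℂ) (φ x)) :=
      Complex.conjCLE.contDiff.comp hφ
    let θ : 𝓢(R3, ℂ) := hc1.toSchwartzMap hc2
    have hθ : ∀ x, (starRingEnd ℂ) (θ x) = φ x := fun x => Complex.conj_conj (φ x)
    have hΔθ : ∀ x, (starRingEnd ℂ) ((Δ θ) x) = Δ φ x := fun x => by
      rw [SchwartzMap.laplacian_apply]
      change (starRingEnd ℂ) (Δ (fun y => (starRingEnd ℂ) (φ y)) x) = _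
      rw [laplacian_conj (contDiff_infty.1 hφ 2), Complex.conj_conj]
    have hd := hasDerivAt_inner_schrodingerPropagator (ħ / (2 * m)) t θ g
    rw [inner_toLp_eq_integral (Δ θ) (hu t ht.le)] at hd
    simp only [hΔθ] at hd
    have hd' : HasDerivAt (fun s => ∫ x, u s x * φ x)
        (Complex.I * (ħ / (2 * m) : ℝ) * ∫ x, u t x * Δ φ x) t := by
      refine hd.congr_of_eventuallyEq ?_
      filter_upwards [Ioi_mem_nhds ht] with s hs
      rw [inner_toLp_eq_integral θ (hu s (le_of_lt hs))]
      simp only [hθ]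
    refine ⟨hd'.differentiableAt, ?_⟩
    rw [hd'.deriv]
    have hm' : (m : ℂ) ≠ 0 := by exact_mod_cast hm.ne'
    push_cast
    field_simp
    rw [Complex.I_sq]
    ring

theorem IsL2FreeSchrodinger.exists_curve {ħ m : ℝ} (hħ : 0 < ħ) (hm : 0 < m)
    {f : R3 → ℂ} {u : ℝ → R3 → ℂ} (hu : IsL2FreeSchrodinger ħ m f u) :
    ∃ w : ℝ → Lp ℂ 2 (volume : Measure R3), ContinuousOn w (Ici 0) ∧
      (∀ t, 0 ≤ t → u t =ᵐ[volume] w t) ∧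
      ∀ θ : 𝓢(R3, ℂ), HasCompactSupport θ → ∀ s : ℝ, 0 < s →
        HasDerivAt (fun s => ⟪θ.toLp 2 volume, w s⟫_ℂ)
          (Complex.I * (ħ / (2 * m) : ℝ) * ⟪(Δ θ).toLp 2 volume, w s⟫_ℂ) s := by
  classical
  -- The default value `0` can occur only at negative times, which play no role.
  let w : ℝ → Lp ℂ 2 (volume : Measure R3) := fun t =>
    if h : MemLp (u t) 2 volume then h.toLp (u t) else 0
  have hw : ∀ t, 0 ≤ t → u t =ᵐ[volume] w t := fun t ht => by
    simp only [w, dif_pos (hu.memLp t ht)]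
    exact (hu.memLp t ht).coeFn_toLp.symm
  refine ⟨w, fun t₀ ht₀ => ?_, hw, fun θ hθ s hs => ?_⟩
  · rw [ContinuousWithinAt, tendsto_iff_edist_tendsto_0]
    refine (hu.continuous_L2 t₀ ht₀).congr' ?_
    filter_upwards [self_mem_nhdsWithin] with t ht
    rw [Lp.edist_def]
    exact eLpNorm_congr_ae ((hw t ht).sub (hw t₀ ht₀))
  · have hθs : ContDiff ℝ ∞ θ := θ.smooth ⊤
    have hc1 : HasCompactSupport (fun x => (starRingEnd ℂ) (θ x)) :=
      hθ.comp_left (g := starRingEnd ℂ) (map_zero _)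
    have hc2 : ContDiff ℝ ∞ (fun x => (starRingEnd ℂ) (θ x)) :=
      Complex.conjCLE.contDiff.comp hθs
    obtain ⟨h1, h2⟩ := hu.weak _ hc2 hc1 s hs
    simp only [laplacian_conj (contDiff_infty.1 hθs 2)] at h2
    have h3 : HasDerivAt (fun s => ⟪θ.toLp 2 volume, w s⟫_ℂ)
        (deriv (fun s => ∫ x, u s x * (starRingEnd ℂ) (θ x)) s) s := by
      refine h1.hasDerivAt.congr_of_eventuallyEq ?_
      filter_upwards [Ioi_mem_nhds hs] with s' hs'
      rw [inner_toLp_eq_integral θ (hw s' (le_of_lt hs'))]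
    refine h3.congr_deriv ?_
    rw [inner_toLp_eq_integral (Δ θ) (hw s hs.le)]
    simp only [SchwartzMap.laplacian_apply]
    have hm' : (m : ℂ) ≠ 0 := by exact_mod_cast hm.ne'
    have hħ' : (ħ : ℂ) ≠ 0 := by exact_mod_cast hħ.ne'
    -- Multiplying by `-i / ħ` solves the weak equation for the time derivative.
    have h4 := congrArg (fun z : ℂ => -Complex.I / ħ * z) h2
    simp only [mul_zero] at h4
    rw [← sub_eq_zero, ← h4]
    push_cast
    field_simp
    ring_nf
    simp only [Complex.I_sq]
    ring

/-- Weak solutions in `C([0, ∞); L²(ℝ³))` of the free Schrödinger equation are unique. -/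
theorem IsL2FreeSchrodinger.ae_eq {ħ m : ℝ} (hħ : 0 < ħ) (hm : 0 < m) {f : R3 → ℂ}
    {u v : ℝ → R3 → ℂ} (hu : IsL2FreeSchrodinger ħ m f u) (hv : IsL2FreeSchrodinger ħ m f v)
    {t : ℝ} (ht : 0 ≤ t) : v t =ᵐ[volume] u t := by
  obtain ⟨wu, hcu, hwu, hdu⟩ := hu.exists_curve hħ hm
  obtain ⟨wv, hcv, hwv, hdv⟩ := hv.exists_curve hħ hm
  have h0 : wv 0 - wu 0 = 0 := by
    rw [sub_eq_zero]
    refine Lp.ext ?_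
    exact (hwv 0 le_rfl).symm.trans ((hv.initial.trans hu.initial.symm).trans (hwu 0 le_rfl))
  have h := eq_zero_of_hasDerivAt_inner (w := fun t => wv t - wu t) (hcv.sub hcu) h0
    (a := ħ / (2 * m)) (fun θ hθ s hs => by
      simp only [inner_sub_right, mul_sub]
      exact (hdv θ hθ s hs).sub (hdu θ hθ s hs)) ht
  have h' : wv t = wu t := sub_eq_zero.1 h
  have hv' := hwv t ht
  rw [h'] at hv'
  exact hv'.trans (hwu t ht).symm

theorem isClassicalFreeSchrodinger_of_eq_ballIntegral {ħ m : ℝ} (hħ : 0 < ħ) (hm : 0 < m)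
    {x₀ : R3} {r : ℝ} {u : ℝ → R3 → ℂ}
    (hu : ∀ t, 0 < t → u t = ballIntegral x₀ r (m / (2 * ħ * t))) :
    IsClassicalFreeSchrodinger ħ m u := by
  have ha : 0 < ħ / (2 * m) := by positivity
  have hM : ∀ t : ℝ, m / (2 * ħ * t) = 1 / (4 * (ħ / (2 * m))) / t := fun t => by
    rw [← div_div]
    congr 1
    field_simp
    norm_num
  simp only [hM] at hu
  refine ⟨?_, fun t ht x => ?_⟩
  · refine (contDiffOn_infty.1 (contDiffOn_ballIntegral x₀ r
      (c := 1 / (4 * (ħ / (2 * m)))) (by positivity)) 2).congr fun p hp => ?_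
    rw [hu p.1 hp.1]
  · have hd : deriv (fun s => u s x) t
        = deriv (fun s => ballIntegral x₀ r (1 / (4 * (ħ / (2 * m))) / s) x) t := by
      refine EventuallyEq.deriv_eq ?_
      filter_upwards [Ioi_mem_nhds ht] with s hs
      rw [hu s hs]
    rw [hd, deriv_ballIntegral_eq_laplacian x₀ r ha ht, hu t ht]
    have hm' : (m : ℂ) ≠ 0 := by exact_mod_cast hm.ne'
    push_cast
    field_simp
    rw [Complex.I_sq]
    ring

end CauchyProblem

theorem proposition2 (ħ m r : ℝ) (hħ : 0 < ħ) (hm : 0 < m) (hr : 0 < r) (x₀ : R3)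
    (u : ℝ → R3 → ℂ)
    (hu_init : ∀ x : R3, u 0 x = ballChar x₀ r x)
    (hu_off : ∀ t : ℝ, 0 < t → ∀ x : R3, x ≠ x₀ →
      u t x = schrodingerProfile (m / (2 * ħ * t)) r ‖x - x₀‖)
    (hu_centre : ∀ t : ℝ, 0 < t → u t x₀ = schrodingerCentre (m / (2 * ħ * t)) r) :
    IsClassicalFreeSchrodinger ħ m u ∧
      IsL2FreeSchrodinger ħ m (ballChar x₀ r) u ∧
      (∀ t : ℝ, 0 < t →
        Tendsto (schrodingerProfile (m / (2 * ħ * t)) r) (𝓝[>] 0)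
          (𝓝 (schrodingerCentre (m / (2 * ħ * t)) r))) ∧
      ∀ v : ℝ → R3 → ℂ, IsL2FreeSchrodinger ħ m (ballChar x₀ r) v →
        ∀ t : ℝ, 0 ≤ t → v t =ᵐ[volume] u t := by
  have hM : ∀ t : ℝ, 0 < t → 0 < m / (2 * ħ * t) := fun t ht => by positivity
  -- Both explicit formulas are values of one integral, so the centre needs no separate treatment
  -- from here on.
  have hu : ∀ t, 0 < t → u t = ballIntegral x₀ r (m / (2 * ħ * t)) := by
    intro t ht
    funext x
    by_cases hx : x = x₀
    · rw [hx, hu_centre t ht, ballIntegral_self (hM t ht) hr]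
    · rw [hu_off t ht x hx, ballIntegral_eq_schrodingerProfile (hM t ht) hr hx]
  have hinit : u 0 =ᵐ[volume] ballChar x₀ r := Eventually.of_forall hu_init
  have hL2 : IsL2FreeSchrodinger ħ m (ballChar x₀ r) u := by
    refine isL2FreeSchrodinger_of_ae_eq_schrodingerPropagator hm
      (g := (memLp_ballChar x₀ r).toLp _) hinit fun t ht => ?_
    rcases ht.eq_or_lt with rfl | ht
    · rw [schrodingerPropagator_zero]
      exact hinit.trans (memLp_ballChar x₀ r).coeFn_toLp.symm
    · have e : 1 / (4 * (ħ / (2 * m) * t)) = m / (2 * ħ * t) := by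
        field_simp
        norm_num
      rw [hu t ht, ← e]
      exact (schrodingerPropagator_ballChar_ae_eq (by positivity) x₀ r).symm
  exact ⟨isClassicalFreeSchrodinger_of_eq_ballIntegral hħ hm hu, hL2,
    fun t ht => tendsto_schrodingerProfile (hM t ht) hr, fun v hv t ht => hL2.ae_eq hħ hm hv ht⟩
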